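/- Let $n=2m$ with $m\ge 2$, and let $\mathcal G$ be a random simple graph on the node set $\mathcal V=\{1,\dots,n\}$ drawn from the stochastic block model with two communities of $m$ nodes each, with labels $y_i\in\{0,1\}$: edges are independent, an edge between two distinct nodes of the same community is present with probability $a$, one between nodes of different communities with probability $b$, where $a,b\in[0,1]$ and $a>\frac{m}{m-1}b$. Let $\mathbf E[\mathcal G]$ be the expected graph, i.e. the weighted graph with adjacency matrix $A=\mathbf E[\text{adjacency matrix of }\mathcal G]$, and let $W_{ij}=A_{ij}/\sum_l A_{il}$ be the transition matrix of its natural random walk. Let $r,w,k\ge 1$ be integers. Start $r$ independent random walks $X^{(v,p)}_1,X^{(v,p)}_2,\dots$ ($p=1,\dots,r$) with transition matrix $W$ at each node $v$. For a walk length $\ell$, let $n^+_{ij}$ be the number of $(v,p,s,s')$ with $1\le s<s'\le\ell$, $s'\le s+w$ and $(X^{(v,p)}_s,X^{(v,p)}_{s'})=(i,j)$. For each such positive pair $(v,p,s,s')$ draw $k$ nodes, conditionally on the walks up to length $\ell$ all independent and distributed according to the empirical distribution of the nodes in all walks up to length $\ell$, and let $n^-_{ij}$ be the number of these draws which equal $j$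 and belong to a positive pair whose first node is $i$. Let $$\bar n^{\pm}_{ij}:=\frac1{rn}\lim_{\ell\to\infty}\frac{n^{\pm}_{ij}}{\ell}$$ be the ergodic limits. Then these limits exist almost surely (as constants), and there are constants $\alpha_1,\alpha_2,\alpha_3$ such that $\bar n^+_{ij}=\alpha_1$ if $i\ne j$ and $y_i=y_j$, $\bar n^+_{ij}=\alpha_2$ if $y_i\neq y_j$, $\bar n^+_{ii}=\alpha_3$, and $\bar n^-_{ij}=\beta:=kw/n^2$ for all $i,j$. With $\sigma(t)=\ln(1+e^{-t})$, put $$f(X)=\sum_{i,j}\left[\bar n^+_{ij}\,\sigma(X_{ij})+\bar n^-_{ij}\,\sigma(-X_{ij})\right],\qquad \nu_1=\ln\frac{\frac{m-1}{m}\alpha_1+\frac1m\alpha_3+\beta}{\alpha_2+\beta},$$ and let $X^*$ be the $n\times n$ matrix with $X^*_{ij}=\nu_1$ if $y_i=y_j$ (including $i=j$) and $X^*_{ij}=-\nu_1$ otherwise. Then $X^*$ has rank $1$, it is the unique minimizer of $f$ over the real symmetric positive semidefinite $n\times n$ matrices, and: 1. for every integer $d\ge 1$, $X^*$ is the unique minimizer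 of $f$ over the positive semidefinite matrices of rank at most $d$ (GramErgoVEC); 2. for every real $\nu_n\ge \nu_1 n$, $X^*$ is the unique minimizer of $f$ over the positive semidefinite matrices with nuclear norm (sum of singular values) at most $\nu_n$ (NucGramErgoVEC). -/

import Mathlib

open MeasureTheory ProbabilityTheory Filter Topology

noncomputable section

/-! ### Random and expected graphs -/

/-- `G` is a random simple graph on `V` distributed as the stochastic block model with block labels
`y` and edge probabilities `B`: two different nodes `i`, `j` are adjacent with probability
`B (y i) (y j)`, and the edges are present independently of each other. -/
structure IsSBM {Ω V : Type*} {K : ℕ} [MeasurableSpace Ω] (μ : Measure Ω) (G : Ω → SimpleGraph V)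
    (y : V → Fin K) (B : Matrix (Fin K) (Fin K) ℝ) : Prop where
  measurable_edge : ∀ e : Sym2 V, MeasurableSet {ω | e ∈ (G ω).edgeSet}
  edge_prob : ∀ i j : V, i ≠ j → μ.real {ω | (G ω).Adj i j} = B (y i) (y j)
  indep : iIndepSet (fun e : {e : Sym2 V // ¬ e.IsDiag} => {ω | e.1 ∈ (G ω).edgeSet}) μ

open Classical in
/-- The weighted adjacency matrix of the expected graph: the entrywise expectation of the
adjacency matrix of the random graph `G`. -/
def expectedAdj {Ω V : Type*} [MeasurableSpace Ω] (μ : Measure Ω) (G : Ω → SimpleGraph V) :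
    Matrix V V ℝ :=
  Matrix.of fun i j => ∫ ω, (G ω).adjMatrix ℝ i j ∂μ

/-- Transition matrix of the natural random walk on the graph with weighted adjacency matrix `A`:
the next node is a neighbour, chosen with probability proportional to the edge weight. -/
def naturalWalk {V : Type*} [Fintype V] (A : Matrix V V ℝ) : Matrix V V ℝ :=
  Matrix.of fun i j => A i j / ∑ l, A i l

/-! ### Random walks, skip-bigram counts and negative sampling -/

/-- `x v p s` is the node visited at time `s` (times start at `0`) by the `p`-th of the `r` walks
started at node `v`. -/
abbrev WalkFamily (V : Type*) (r : ℕ) := V → Fin r → ℕ → V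

/-- Pairs of times `s < s' ≤ s + w` in a walk of length `ℓ`. -/
abbrev SkipPosition (ℓ w : ℕ) := {e : Fin ℓ × Fin ℓ // e.1 < e.2 ∧ (e.2 : ℕ) ≤ (e.1 : ℕ) + w}

/-- Positions of the negative samples: `k` of them for each positive pair, i.e. for each start node,
walk started there, and pair of times within the window. -/
abbrev NegPosition (V : Type*) (r w k ℓ : ℕ) := (V × Fin r × SkipPosition ℓ w) × Fin k

section Counts

variable {V : Type*} [Fintype V] [DecidableEq V] {r : ℕ}

/-- Multiplicity of `(i, j)` in the positive multiset of the walks `x`, cut off at length `ℓ`. -/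
def posCount (x : WalkFamily V r) (w ℓ : ℕ) (i j : V) : ℕ :=
  Fintype.card {q : V × Fin r × SkipPosition ℓ w //
    x q.1 q.2.1 q.2.2.1.1 = i ∧ x q.1 q.2.1 q.2.2.1.2 = j}

/-- Multiplicity of `(i, j)` in the negative multiset: each negative sample keeps the first node of
its positive pair and has the sampled node as second component. -/
def negCount (x : WalkFamily V r) {w k ℓ : ℕ} (z : NegPosition V r w k ℓ → V) (i j : V) : ℕ :=
  Fintype.card {q : NegPosition V r w k ℓ // x q.1.1 q.1.2.1 q.1.2.2.1.1 = i ∧ z q = j}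

/-- Empirical unigram distribution of the nodes in all the walks `x`, cut off at length `ℓ`. -/
def unigram (x : WalkFamily V r) (ℓ : ℕ) (j : V) : ℝ :=
  (Fintype.card {q : V × Fin r × Fin ℓ // x q.1 q.2.1 q.2.2 = j} : ℝ) /
    ((Fintype.card V : ℝ) * r * ℓ)

/-- Probability that the Markov chain with transition matrix `W` started at `v` follows the first
`ℓ ≥ 1` nodes of `x`. -/
def walkProb (W : Matrix V V ℝ) (v : V) (ℓ : ℕ) (x : ℕ → V) : ℝ :=
  (if x 0 = v then 1 else 0) * ∏ s ∈ Finset.range (ℓ - 1), W (x s) (x (s + 1))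

/-- The random walks `X` and, for each walk length `ℓ`, the negative samples `Z ℓ` drawn from the
walks of that length, with transition matrix `W`, `r` walks per node, window `w` and `k` negative
samples per positive pair: the walks are independent Markov chains and, given the walks up to length
`ℓ`, the negative samples are independent with the empirical unigram distribution. Nothing is
prescribed on how negative samples for different lengths are coupled. -/
structure IsVECSampling {Ω : Type*} [MeasurableSpace Ω] (μ : Measure Ω) (W : Matrix V V ℝ)
    (w k : ℕ) (X : Ω → WalkFamily V r) (Z : (ℓ : ℕ) → Ω → NegPosition V r w k ℓ → V) : Prop where
  measurable_walk : ∀ v p s i, MeasurableSet {ω | X ω v p s = i}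
  measurable_neg : ∀ ℓ q i, MeasurableSet {ω | Z ℓ ω q = i}
  law : ∀ ℓ : ℕ, 1 ≤ ℓ → ∀ (x : WalkFamily V r) (z : NegPosition V r w k ℓ → V),
    μ.real {ω | (∀ v p, ∀ s < ℓ, X ω v p s = x v p s) ∧ Z ℓ ω = z} =
      (∏ v, ∏ p, walkProb W v ℓ (x v p)) * ∏ q, unigram x ℓ (z q)

/-- `Nplus` and `Nminus` are the matrices of ergodic limits: almost surely, the positive and the
negative counts, divided by `r n ℓ`, converge to their entries as the walk length `ℓ` grows. -/
def IsErgodicLimit {Ω : Type*} [MeasurableSpace Ω] (μ : Measure Ω) {w k : ℕ}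
    (X : Ω → WalkFamily V r) (Z : (ℓ : ℕ) → Ω → NegPosition V r w k ℓ → V)
    (Nplus Nminus : Matrix V V ℝ) : Prop :=
  ∀ i j : V, ∀ᵐ ω ∂μ,
    Tendsto (fun ℓ : ℕ => 1 / ((r : ℝ) * Fintype.card V) * ((posCount (X ω) w ℓ i j : ℝ) / ℓ))
      atTop (𝓝 (Nplus i j)) ∧
    Tendsto (fun ℓ : ℕ => 1 / ((r : ℝ) * Fintype.card V) * ((negCount (X ω) (Z ℓ ω) i j : ℝ) / ℓ))
      atTop (𝓝 (Nminus i j))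

end Counts

/-! ### The Gram-matrix optimization problems -/

/-- The logistic loss. -/
def logisticLoss (t : ℝ) : ℝ := Real.log (1 + Real.exp (-t))

/-- The objective `f(N⁺, N⁻, X)`. -/
def gramObjective {V : Type*} [Fintype V] (Nplus Nminus X : Matrix V V ℝ) : ℝ :=
  ∑ i, ∑ j, (Nplus i j * logisticLoss (X i j) + Nminus i j * logisticLoss (-X i j))

/-- The set of minimizers of `f` over `H`. -/
def argminSet {E : Type*} (f : E → ℝ) (H : Set E) : Set E := {x | x ∈ H ∧ IsMinOn f H x}

/-- The nuclear norm: the sum of the singular values. -/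
def nuclearNorm {V : Type*} [Fintype V] [DecidableEq V] (X : Matrix V V ℝ) : ℝ :=
  ∑ i ∈ Finset.range (Fintype.card V), (Matrix.toEuclideanLin X).singularValues i

/-- The real symmetric positive semidefinite matrices. -/
def psdCone (V : Type*) : Set (Matrix V V ℝ) := {X | X.PosSemidef}

/-- The positive semidefinite matrices of rank at most `d`. -/
def psdRankLE (V : Type*) [Fintype V] (d : ℕ) : Set (Matrix V V ℝ) :=
  {X | X.PosSemidef ∧ X.rank ≤ d}

/-- The positive semidefinite matrices of nuclear norm at most `c`. -/
def psdNuclearLE (V : Type*) [Fintype V] [DecidableEq V] (c : ℝ) : Set (Matrix V V ℝ) :=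
  {X | X.PosSemidef ∧ nuclearNorm X ≤ c}

/-- The constant `ν₁ = ln ((ᾱ₁₃ + β) / (α₂ + β))` with `ᾱ₁₃ = (m - 1)/m α₁ + 1/m α₃`. -/
def nuOne (m : ℕ) (α₁ α₂ α₃ β : ℝ) : ℝ :=
  Real.log (((((m : ℝ) - 1) / m * α₁ + 1 / m * α₃) + β) / (α₂ + β))

/-- The matrix with entries `t` within communities (and on the diagonal) and `-t` across. -/
def communityGram {V : Type*} {K : ℕ} (y : V → Fin K) (t : ℝ) : Matrix V V ℝ :=
  Matrix.of fun i j => if y i = y j then t else -t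

end

/-!
The proof has a probabilistic half, which identifies the ergodic limits, and a convex-analytic half,
which solves the optimization problem they define.

Ergodic limits. The transition matrix `W` of the expected graph is symmetric and lies in the algebra
of block matrices: its eigenvalues are `1`, `lam = ((m - 1) a - m b) / D` on the `±1` vector of the
communities and `-th = -a / D` on the vectors summing to zero in each community, where `D` is the
expected degree (`pow_eq_blockKernel`). The chain may be periodic (`m = 2`, `b = 0`) or reducible
(`b = 0`), so convergence of `W ^ t` is not available. Instead, the centred indicators of a step to
`j`, taken whenever the walk was at `i` exactly `t` steps earlier, form bounded martingale
differences. Their exponential moments are controlled by conditioning on one step at a time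
(`integral_mul_le_of_conditional`), and Chernoff bounds with Borel-Cantelli make their averages tend
to zero almost surely (`ae_tendsto_div_zero_of_exp_moment`). This shows that pairs at lag `t` occur
with frequency `W ^ t` relative to the visits of their first node, and that the empirical
distribution of the visits is asymptotically stationary. Stationarity makes it uniform if
`b > 0`. If `b = 0`, each walk stays in its community, and uniformity holds because equally many walks start in
both communities (`tendsto_totalVisits`). The negative samples are independent given the walks, so
the same exponential bound applies to them. It is summable in the walk length, so no assumption on
the coupling between different lengths is needed.

Optimization. As `β > 0`, the objective is strictly convex, and a matrix `X₀` is its unique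
minimizer over the positive semidefinite cone as soon as the gradient at `X₀` pairs to zero with
`X₀` and nonnegatively with every positive semidefinite matrix. At `communityGram y ν₁` the gradient
is a combination of the all-ones, same-block and identity matrices. Its eigenvalue on the `±1`
vector vanishes by the choice of `ν₁`. The one on the constants is nonnegative because
`α₂ ((m - 1) / m * α₁ + 1 / m * α₃) ≤ β ^ 2`, and the one on the block-centred vectors because
`α₃ ≤ α₁`, which reflects that the sum of `(-th) ^ t` over `1 ≤ t ≤ w` is nonpositive
(`gramObjective_communityGram_lt`). The minimizer has rank `1` and nuclear norm at most `ν₁ n`, so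
it is feasible for the two constrained problems and remains their unique minimizer.
-/

/-! ### The objective and its first-order condition -/

/-- Strict convexity of `log (1 + exp x)`, obtained by weighing `exp 0` and `exp (x - x₀)` with
`1 - sigmoid x₀` and `sigmoid x₀`. -/
theorem log_one_add_exp_tangent_lt {x x₀ : ℝ} (hx : x ≠ x₀) :
    Real.log (1 + Real.exp x₀) + Real.sigmoid x₀ * (x - x₀) < Real.log (1 + Real.exp x) := by
  have h0 := Real.exp_pos x₀
  have hp : Real.sigmoid x₀ = Real.exp x₀ / (1 + Real.exp x₀) := by
    rw [Real.sigmoid_def, Real.exp_neg]; field_simp; ring_nf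
  have hp0 := Real.sigmoid_pos x₀
  have hp1 := Real.sigmoid_lt_one x₀
  have hconv := strictConvexOn_exp.2 (Set.mem_univ 0) (Set.mem_univ (x - x₀))
    (sub_ne_zero.2 hx).symm (sub_pos.2 hp1) hp0 (by ring)
  have hlog := Real.log_lt_log (Real.exp_pos _) hconv
  have hq : (1 - Real.sigmoid x₀) • Real.exp 0 + Real.sigmoid x₀ • Real.exp (x - x₀) =
      (1 + Real.exp x) / (1 + Real.exp x₀) := by
    rw [hp, Real.exp_sub, smul_eq_mul, smul_eq_mul, Real.exp_zero]; field_simp; ring_nf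
  rw [hq, Real.log_exp, Real.log_div (by positivity) (by positivity)] at hlog
  simp only [smul_eq_mul, mul_zero, zero_add] at hlog
  linarith

theorem logisticLoss_tangent_le (x x₀ : ℝ) :
    logisticLoss x₀ - Real.sigmoid (-x₀) * (x - x₀) ≤ logisticLoss x := by
  rcases eq_or_ne x x₀ with rfl | hx
  · simp
  · have := log_one_add_exp_tangent_lt (x := -x) (x₀ := -x₀) (by simpa using hx)
    unfold logisticLoss
    nlinarith

theorem logisticLoss_neg_tangent_lt {x x₀ : ℝ} (hx : x ≠ x₀) :
    logisticLoss (-x₀) + Real.sigmoid x₀ * (x - x₀) < logisticLoss (-x) := by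
  simpa [logisticLoss] using log_one_add_exp_tangent_lt hx

/-- The gradient of `gramObjective Nplus Nminus` at `X`. -/
noncomputable def gramGradient {V : Type*} (Nplus Nminus X : Matrix V V ℝ) : Matrix V V ℝ :=
  Matrix.of fun i j => Nminus i j * Real.sigmoid (X i j) - Nplus i j * Real.sigmoid (-X i j)

/-- The first-order condition for the strictly convex function `gramObjective`. -/
theorem gramObjective_lt_of_gradient {V : Type*} [Fintype V] {Nplus Nminus X X₀ : Matrix V V ℝ}
    (hp : ∀ i j, 0 ≤ Nplus i j) (hm : ∀ i j, 0 < Nminus i j) (hne : X ≠ X₀)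
    (hgrad : 0 ≤ ∑ i, ∑ j, gramGradient Nplus Nminus X₀ i j * (X i j - X₀ i j)) :
    gramObjective Nplus Nminus X₀ < gramObjective Nplus Nminus X := by
  have hle : ∀ i j, Nplus i j * logisticLoss (X₀ i j) + Nminus i j * logisticLoss (-X₀ i j) +
      gramGradient Nplus Nminus X₀ i j * (X i j - X₀ i j) ≤
      Nplus i j * logisticLoss (X i j) + Nminus i j * logisticLoss (-X i j) := by
    intro i j
    have h1 := mul_le_mul_of_nonneg_left (logisticLoss_tangent_le (X i j) (X₀ i j)) (hp i j)
    have h2 : logisticLoss (-X₀ i j) + Real.sigmoid (X₀ i j) * (X i j - X₀ i j) ≤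
        logisticLoss (-X i j) := by
      rcases eq_or_ne (X i j) (X₀ i j) with h | h
      · simp [h]
      · exact (logisticLoss_neg_tangent_lt h).le
    have h3 := mul_le_mul_of_nonneg_left h2 (hm i j).le
    simp only [gramGradient, Matrix.of_apply]
    linarith
  obtain ⟨i₀, j₀, hij⟩ : ∃ i j, X i j ≠ X₀ i j := by
    by_contra! h
    exact hne (Matrix.ext h)
  have hlt : Nplus i₀ j₀ * logisticLoss (X₀ i₀ j₀) + Nminus i₀ j₀ * logisticLoss (-X₀ i₀ j₀) +
      gramGradient Nplus Nminus X₀ i₀ j₀ * (X i₀ j₀ - X₀ i₀ j₀) <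
      Nplus i₀ j₀ * logisticLoss (X i₀ j₀) + Nminus i₀ j₀ * logisticLoss (-X i₀ j₀) := by
    have h1 := mul_le_mul_of_nonneg_left (logisticLoss_tangent_le (X i₀ j₀) (X₀ i₀ j₀)) (hp i₀ j₀)
    have h3 := mul_lt_mul_of_pos_left (logisticLoss_neg_tangent_lt hij) (hm i₀ j₀)
    simp only [gramGradient, Matrix.of_apply]
    linarith
  have hsum : ∑ i, ∑ j, (Nplus i j * logisticLoss (X₀ i j) + Nminus i j * logisticLoss (-X₀ i j) +
      gramGradient Nplus Nminus X₀ i j * (X i j - X₀ i j)) < gramObjective Nplus Nminus X :=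
    Finset.sum_lt_sum (fun i _ => Finset.sum_le_sum fun j _ => hle i j)
      ⟨i₀, Finset.mem_univ _, Finset.sum_lt_sum (fun j _ => hle i₀ j) ⟨j₀, Finset.mem_univ _, hlt⟩⟩
  simp only [Finset.sum_add_distrib] at hsum
  simp only [gramObjective, Finset.sum_add_distrib] at hsum ⊢
  linarith

theorem Matrix.PosSemidef.sum_sum_nonneg {V : Type*} [Fintype V] {X : Matrix V V ℝ}
    (hX : X.PosSemidef) (u : V → ℝ) : 0 ≤ ∑ i, ∑ j, u i * X i j * u j := by
  have h := hX.dotProduct_mulVec_nonneg u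
  simp only [dotProduct, Matrix.mulVec, Finset.mul_sum, star_trivial] at h
  simpa only [mul_assoc] using h

theorem Matrix.PosSemidef.apply_add_apply_le {V : Type*} [Fintype V] [DecidableEq V]
    {X : Matrix V V ℝ} (hX : X.PosSemidef) (i j : V) : X i j + X j i ≤ X i i + X j j := by
  have h := hX.dotProduct_mulVec_nonneg (Pi.single i 1 - Pi.single j 1)
  simp [Matrix.mulVec_sub, sub_dotProduct, dotProduct_sub] at h
  linarith

/-- For labels with blocks of size `m`, the within-block entries of a positive semidefinite matrix
sum to at most `m` times its trace: the projection onto the block-constant vectors does not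
increase the trace. -/
theorem Matrix.PosSemidef.sum_sameBlock_le {V : Type*} [Fintype V] {K : ℕ}
    {X : Matrix V V ℝ} (hX : X.PosSemidef) (y : V → Fin K) (m : ℕ)
    (hy : ∀ i, (Finset.univ.filter fun j => y i = y j).card = m) :
    ∑ i, ∑ j, (if y i = y j then X i j else 0) ≤ m * ∑ i, X i i := by
  classical
  have hrow : ∑ i, ∑ j, (if y i = y j then X i i else 0) = m * ∑ i, X i i := by
    rw [Finset.mul_sum]
    refine Finset.sum_congr rfl fun i _ => ?_
    rw [← Finset.sum_filter, Finset.sum_const, hy i, nsmul_eq_mul]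
  have hcol : ∑ i, ∑ j, (if y i = y j then X j j else 0) = m * ∑ i, X i i := by
    rw [Finset.sum_comm, ← hrow]
    simp only [eq_comm]
  have hswap : ∑ i, ∑ j, (if y i = y j then X j i else 0) =
      ∑ i, ∑ j, (if y i = y j then X i j else 0) := by
    rw [Finset.sum_comm]
    simp only [eq_comm]
  have hle : ∑ i, ∑ j, ((if y i = y j then X i j else 0) + (if y i = y j then X j i else 0)) ≤
      ∑ i, ∑ j, ((if y i = y j then X i i else 0) + (if y i = y j then X j j else 0)) := by
    refine Finset.sum_le_sum fun i _ => Finset.sum_le_sum fun j _ => ?_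
    split_ifs
    · exact hX.apply_add_apply_le i j
    · simp
  simp only [Finset.sum_add_distrib, hrow, hcol, hswap] at hle
  linarith

theorem card_sameBlock {n m : ℕ} {y : Fin n → Fin 2}
    (hy : ∀ c : Fin 2, (Finset.univ.filter fun i => y i = c).card = m) (i : Fin n) :
    (Finset.univ.filter fun j => y i = y j).card = m := by
  simpa [eq_comm] using hy (y i)

theorem card_otherBlock {n m : ℕ} (hn : n = 2 * m) {y : Fin n → Fin 2}
    (hy : ∀ c : Fin 2, (Finset.univ.filter fun i => y i = c).card = m) (i : Fin n) :
    (Finset.univ.filter fun j => ¬ y i = y j).card = m := by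
  have h := Finset.card_filter_add_card_filter_not (s := Finset.univ) (fun j => y i = y j)
  rw [card_sameBlock hy, Finset.card_univ, Fintype.card_fin] at h
  omega

theorem sum_ite_sameBlock {n m : ℕ} (hn : n = 2 * m) {y : Fin n → Fin 2}
    (hy : ∀ c : Fin 2, (Finset.univ.filter fun i => y i = c).card = m) (i : Fin n) (s t : ℝ) :
    ∑ j, (if y i = y j then s else t) = m * s + m * t := by
  rw [Finset.sum_ite, Finset.sum_const, Finset.sum_const, card_sameBlock hy,
    card_otherBlock hn hy, nsmul_eq_mul, nsmul_eq_mul]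

/-- `communityGram y t` is `t` times the outer square of the `±1` vector of the communities. -/
theorem communityGram_eq_smul {V : Type*} (y : V → Fin 2) (t : ℝ) :
    communityGram y t = t • Matrix.vecMulVec (fun i => if y i = 0 then (1 : ℝ) else -1)
      (star fun i => if y i = 0 then (1 : ℝ) else -1) := by
  ext i j
  simp only [communityGram, Matrix.of_apply, Matrix.smul_apply, Matrix.vecMulVec_apply,
    star_trivial, smul_eq_mul]
  generalize y i = p
  generalize y j = q
  fin_cases p <;> fin_cases q <;> simp

theorem communityGram_posSemidef {V : Type*} [Finite V] (y : V → Fin 2) {t : ℝ} (ht : 0 ≤ t) :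
    (communityGram y t).PosSemidef := by
  rw [communityGram_eq_smul]
  exact (Matrix.posSemidef_vecMulVec_self_star _).smul ht

theorem communityGram_rank_le {V : Type*} [Fintype V] (y : V → Fin 2) (t : ℝ) :
    (communityGram y t).rank ≤ 1 := by
  rw [communityGram_eq_smul, ← Matrix.smul_vecMulVec]
  exact Matrix.rank_vecMulVec_le _ _

theorem communityGram_rank {V : Type*} [Fintype V] [DecidableEq V] [Nonempty V] (y : V → Fin 2)
    {t : ℝ} (ht : t ≠ 0) : (communityGram y t).rank = 1 := by
  refine le_antisymm (communityGram_rank_le y t) (Nat.one_le_iff_ne_zero.2 fun h => ht ?_)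
  rw [Matrix.rank, Submodule.finrank_eq_zero, LinearMap.range_eq_bot] at h
  replace h : communityGram y t = 0 := by
    rw [← Matrix.toLin'_apply'] at h
    simpa using h
  obtain ⟨i⟩ := ‹Nonempty V›
  simpa [communityGram] using congrFun (congrFun h i) i

theorem communityGram_mul_self {n : ℕ} (y : Fin n → Fin 2) (t : ℝ) :
    communityGram y t * communityGram y t = (t * n) • communityGram y t := by
  have hs : (star fun i => if y i = 0 then (1 : ℝ) else -1) ⬝ᵥ
      (fun i => if y i = 0 then (1 : ℝ) else -1) = n := by
    simp only [dotProduct, Pi.star_apply, star_trivial]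
    rw [Finset.sum_congr rfl (g := fun _ => (1 : ℝ)) (by intro i _; split_ifs <;> simp)]
    simp
  rw [communityGram_eq_smul, Matrix.smul_mul, Matrix.mul_smul, Matrix.vecMulVec_mul_vecMulVec, hs]
  ext i j
  simp [Matrix.vecMulVec_apply]
  ring_nf

/-- Only the first singular value of a matrix of rank one can be nonzero. With `M` the community
matrix, `M * M = (t * n) • M` forces its square `s` to satisfy `s ^ 2 = (t * n) ^ 2 * s`. -/
theorem nuclearNorm_communityGram_le {n : ℕ} (y : Fin n → Fin 2) {t : ℝ}
    (ht : 0 ≤ t) : nuclearNorm (communityGram y t) ≤ t * n := by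
  set M := communityGram y t with hM
  set T := Matrix.toEuclideanLin M with hT
  have hMM : M * M = (t * n) • M := communityGram_mul_self y t
  have hadj : LinearMap.adjoint T = T := by
    rw [hT, ← Matrix.toEuclideanLin_conjTranspose_eq_adjoint,
      (communityGram_posSemidef y ht).isHermitian.eq]
  have hTT : T ∘ₗ T = (t * n) • T := by
    have hcomp : T ∘ₗ T = Matrix.toEuclideanLin (M * M) := by
      ext v i
      simp [hT, Matrix.toLpLin_apply, Matrix.mulVec_mulVec]
    rw [hcomp, hMM, map_smul]
  have hrank : Module.finrank ℝ T.range ≤ 1 := by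
    have := communityGram_rank_le y t
    rwa [← hM, Matrix.rank_eq_finrank_range_toLin M (EuclideanSpace.basisFun _ ℝ).toBasis
      (EuclideanSpace.basisFun _ ℝ).toBasis, ← Matrix.toEuclideanLin_eq_toLin_orthonormal] at this
  have hzero : ∀ i, 1 ≤ i → T.singularValues i = 0 := fun i hi =>
    T.singularValues_eq_zero_iff_le_finrank_range.2 (hrank.trans hi)
  have htn : 0 ≤ t * n := by positivity
  rcases Nat.eq_zero_or_pos n with h0 | h0
  · subst h0
    simp [nuclearNorm]
  have hsum : nuclearNorm M = T.singularValues 0 := by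
    rw [nuclearNorm, Fintype.card_fin]
    refine Finset.sum_eq_single_of_mem 0 (by simpa using h0) fun i _ hi => hzero i (by omega)
  rw [hsum]
  have hev := T.hasEigenvalue_adjoint_comp_self_sq_singularValues (n := 0) (by simpa using h0)
  obtain ⟨v, hv⟩ := hev.exists_hasEigenvector
  have hv1 : (t * n) • T v = (T.singularValues 0 ^ 2) • v := by
    have := hv.apply_eq_smul
    rw [hadj, hTT] at this
    simpa using this
  have hv2 : (t * n) • (T.singularValues 0 ^ 2) • v = (T.singularValues 0 ^ 2) • T v := by
    have := congrArg T hv1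
    rw [map_smul, map_smul] at this
    rw [← this, ← hv1]
    congr 1
    simpa using (LinearMap.congr_fun hTT v).symm
  have hv3 : ((t * n) ^ 2 * T.singularValues 0 ^ 2 - (T.singularValues 0 ^ 2) ^ 2) • v = 0 := by
    have h := congrArg (fun z => (t * n) • z) hv2
    beta_reduce at h
    rw [smul_comm (t * (n : ℝ)) (T.singularValues 0 ^ 2) (T v), hv1, smul_smul, smul_smul,
      smul_smul] at h
    rw [sub_smul, sub_eq_zero]
    convert h using 2 <;> ring
  have hzero' := (smul_eq_zero.1 hv3).resolve_right hv.2
  have hs0 := T.singularValues_nonneg 0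
  by_contra! hlt
  have hpos : 0 < T.singularValues 0 := htn.trans_lt hlt
  have : 0 < T.singularValues 0 ^ 2 * (T.singularValues 0 ^ 2 - (t * n) ^ 2) := by
    apply mul_pos (by positivity)
    nlinarith
  nlinarith

/-! ### Optimality of the community matrix -/

/-- Summing a combination of the all-ones, same-block and identity patterns against a positive
semidefinite matrix. The coefficient condition makes the combination vanish on the `±1` vector of
the communities. -/
theorem Matrix.PosSemidef.sum_blockPattern_nonneg {n m : ℕ} (hm : 1 ≤ m) {y : Fin n → Fin 2}
    (hy : ∀ c : Fin 2, (Finset.univ.filter fun i => y i = c).card = m)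
    {X : Matrix (Fin n) (Fin n) ℝ} (hX : X.PosSemidef) {g h e : ℝ} (hg : 0 ≤ g) (he : 0 ≤ e)
    (hker : e + m * h = 0) :
    0 ≤ ∑ i, ∑ j, (g + (if y i = y j then h else 0) + if i = j then e else 0) * X i j := by
  have hm' : (0 : ℝ) < m := by exact_mod_cast hm
  have hall : 0 ≤ ∑ i, ∑ j, X i j := by simpa using hX.sum_sum_nonneg fun _ => 1
  have hblock := hX.sum_sameBlock_le y m (card_sameBlock hy)
  have hsum : ∑ i, ∑ j, (g + (if y i = y j then h else 0) + if i = j then e else 0) * X i j =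
      g * (∑ i, ∑ j, X i j) + h * (∑ i, ∑ j, if y i = y j then X i j else 0) +
        e * ∑ i, X i i := by
    simp only [add_mul, Finset.sum_add_distrib, ite_mul, zero_mul, Finset.sum_ite_eq,
      Finset.mem_univ, if_true, Finset.mul_sum, mul_ite, mul_zero]
  rw [hsum]
  have hh : h = -(e / m) := by field_simp; linarith
  have h2 : e / m * (∑ i, ∑ j, if y i = y j then X i j else 0) ≤ e * ∑ i, X i i := by
    have := mul_le_mul_of_nonneg_left hblock (div_nonneg he hm'.le)
    rwa [← mul_assoc, div_mul_cancel₀ _ hm'.ne'] at this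
  rw [hh]
  nlinarith [mul_nonneg hg hall]

theorem sum_blockPattern_communityGram {n m : ℕ} (hn : n = 2 * m) {y : Fin n → Fin 2}
    (hy : ∀ c : Fin 2, (Finset.univ.filter fun i => y i = c).card = m)
    {g h e : ℝ} (hker : e + m * h = 0) (t : ℝ) :
    ∑ i, ∑ j, (g + (if y i = y j then h else 0) + if i = j then e else 0) *
      communityGram y t i j = 0 := by
  refine Finset.sum_eq_zero fun i _ => ?_
  have hrow : ∀ j, (g + (if y i = y j then h else 0) + if i = j then e else 0) *
      communityGram y t i j =
      (if y i = y j then (g + h) * t else -(g * t)) + if i = j then e * t else 0 := by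
    intro j
    by_cases hij : i = j
    · subst hij; simp [communityGram]; ring
    · by_cases hyij : y i = y j <;> simp [communityGram, hij, hyij]
  rw [Finset.sum_congr rfl fun j _ => hrow j, Finset.sum_add_distrib, sum_ite_sameBlock hn hy,
    Finset.sum_ite_eq, if_pos (Finset.mem_univ _)]
  linear_combination t * hker

/-- The optimality conditions at `communityGram y ν₁`: the gradient of the objective there is
positive semidefinite and orthogonal to `communityGram y ν₁`. -/
theorem gramObjective_communityGram_lt {n m : ℕ} (hm : 1 ≤ m) (hn : n = 2 * m) {y : Fin n → Fin 2}
    (hy : ∀ c : Fin 2, (Finset.univ.filter fun i => y i = c).card = m)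
    {α₁ α₂ α₃ β : ℝ} (h₁ : 0 ≤ α₁) (h₂ : 0 ≤ α₂) (h₃ : 0 ≤ α₃) (hβ : 0 < β) (h₃₁ : α₃ ≤ α₁)
    (hsq : α₂ * (((m : ℝ) - 1) / m * α₁ + 1 / m * α₃) ≤ β ^ 2)
    {Nplus Nminus : Matrix (Fin n) (Fin n) ℝ}
    (hp : ∀ i j, Nplus i j = if i = j then α₃ else if y i = y j then α₁ else α₂)
    (hmin : ∀ i j, Nminus i j = β)
    {X : Matrix (Fin n) (Fin n) ℝ} (hX : X.PosSemidef)
    (hne : X ≠ communityGram y (nuOne m α₁ α₂ α₃ β)) :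
    gramObjective Nplus Nminus (communityGram y (nuOne m α₁ α₂ α₃ β)) <
      gramObjective Nplus Nminus X := by
  have hm' : (1 : ℝ) ≤ m := by exact_mod_cast hm
  set A : ℝ := ((m : ℝ) - 1) / m * α₁ + 1 / m * α₃ with hA
  have hA0 : 0 ≤ A := by
    have : (0 : ℝ) ≤ m - 1 := by linarith
    positivity
  have hmA : m * A = (m - 1) * α₁ + α₃ := by rw [hA]; field_simp
  set ν := nuOne m α₁ α₂ α₃ β with hν
  set q := Real.sigmoid ν with hq
  have hexp : Real.exp ν = (A + β) / (α₂ + β) := by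
    rw [hν, nuOne, ← hA, Real.exp_log (by positivity)]
  have hq0 : 0 < q := Real.sigmoid_pos ν
  have hq1 : q < 1 := Real.sigmoid_lt_one ν
  -- `q = (A + β) / (A + α₂ + 2 β)`
  have hqeq : q * (A + α₂ + 2 * β) = A + β := by
    rw [hq, Real.sigmoid_def, Real.exp_neg, hexp]
    field_simp
    ring
  have hqn : Real.sigmoid (-ν) = 1 - q := Real.sigmoid_neg ν
  have hg2 : 0 ≤ β * (1 - q) - α₂ * q := by
    have hpos : 0 < A + α₂ + 2 * β := by positivity
    refine nonneg_of_mul_nonneg_left (b := A + α₂ + 2 * β) ?_ hpos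
    nlinarith
  -- the gradient annihilates the `±1` vector; this is where the value of `ν₁` enters
  have hker : (1 - q) * (α₁ - α₃) + m * ((β * q - α₁ * (1 - q)) - (β * (1 - q) - α₂ * q)) = 0 := by
    linear_combination m * hqeq + (1 - q) * hmA
  have hgrad : ∀ i j, gramGradient Nplus Nminus (communityGram y ν) i j =
      (β * (1 - q) - α₂ * q) +
        (if y i = y j then (β * q - α₁ * (1 - q)) - (β * (1 - q) - α₂ * q) else 0) +
        if i = j then (1 - q) * (α₁ - α₃) else 0 := by
    intro i j
    simp only [gramGradient, Matrix.of_apply, communityGram, hp, hmin]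
    by_cases hij : i = j
    · subst hij; simp only [if_true, hqn, ← hq]; ring
    · by_cases hyij : y i = y j
      · simp only [hij, hyij, if_true, if_false, hqn, ← hq]; ring
      · simp only [hij, hyij, if_false, hqn, neg_neg, ← hq]; ring
  refine gramObjective_lt_of_gradient (fun i j => ?_) (fun i j => ?_) hne ?_
  · rw [hp]; split_ifs <;> assumption
  · rw [hmin]; exact hβ
  · simp only [mul_sub, Finset.sum_sub_distrib]
    simp only [hgrad]
    rw [sum_blockPattern_communityGram hn hy hker, sub_zero]
    exact hX.sum_blockPattern_nonneg hm hy hg2 (mul_nonneg (by linarith) (by linarith)) hker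

theorem argminSet_eq_singleton {E : Type*} {f : E → ℝ} {H : Set E} {x₀ : E} (h₀ : x₀ ∈ H)
    (hlt : ∀ x ∈ H, x ≠ x₀ → f x₀ < f x) : argminSet f H = {x₀} := by
  ext x
  simp only [argminSet, Set.mem_ofPred_eq, Set.mem_singleton_iff]
  constructor
  · rintro ⟨hx, hmin⟩
    by_contra hne
    exact (hlt x hx hne).not_ge (hmin h₀)
  · rintro rfl
    refine ⟨h₀, fun z hz => ?_⟩
    rcases eq_or_ne z x with rfl | hne
    · exact le_refl (f z)
    · exact (hlt z hz hne).le

/-! ### Expected graph and powers of the transition matrix -/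

theorem expectedAdj_apply {Ω V : Type*} [DecidableEq V] [MeasurableSpace Ω] {μ : Measure Ω} {K : ℕ}
    {G : Ω → SimpleGraph V} {y : V → Fin K} {B : Matrix (Fin K) (Fin K) ℝ} (hG : IsSBM μ G y B)
    (i j : V) : expectedAdj μ G i j = if i = j then 0 else B (y i) (y j) := by
  classical
  simp only [expectedAdj, Matrix.of_apply, SimpleGraph.adjMatrix_apply]
  split_ifs with hij
  · subst hij; simp
  · rw [← hG.edge_prob i j hij]
    have hmeas : MeasurableSet {ω | (G ω).Adj i j} := by
      simpa using hG.measurable_edge s(i, j)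
    have := integral_indicator_one (μ := μ) hmeas
    rw [← this]
    congr 1 with ω

/-- The entries of the `t`-step transition matrix of a block-symmetric walk, in terms of the
eigenvalues `1`, `lam` (on the `±1` vector of the communities) and `-th` (on the vectors summing to
zero in each community). -/
noncomputable def blockKernel (m : ℕ) {n : ℕ} (y : Fin n → Fin 2) (lam th : ℝ) (t : ℕ) :
    Matrix (Fin n) (Fin n) ℝ :=
  Matrix.of fun i j => 1 / n + lam ^ t * (if y i = y j then 1 else -1) / n +
    (-th) ^ t * ((if i = j then 1 else 0) - (if y i = y j then 1 / (m : ℝ) else 0))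

theorem sum_sameBlock_mul {n m : ℕ} {y : Fin n → Fin 2}
    (hy : ∀ c : Fin 2, (Finset.univ.filter fun i => y i = c).card = m) (i j : Fin n) (s t : ℝ) :
    ∑ k, (if y i = y k then 1 else 0) * (if y k = y j then s else t) =
      m * if y i = y j then s else t := by
  have : ∀ k, (if y i = y k then (1 : ℝ) else 0) * (if y k = y j then s else t) =
      if y i = y k then (if y i = y j then s else t) else 0 := by
    intro k
    by_cases h : y i = y k <;> simp [h]
  rw [Finset.sum_congr rfl fun k _ => this k, ← Finset.sum_filter, Finset.sum_const,
    card_sameBlock hy, nsmul_eq_mul]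

theorem sum_blockKernel_left {n m : ℕ} (hm : 1 ≤ m) (hn : n = 2 * m) {y : Fin n → Fin 2}
    (hy : ∀ c : Fin 2, (Finset.univ.filter fun i => y i = c).card = m) (lam th : ℝ) (t : ℕ)
    (j : Fin n) : ∑ k, blockKernel m y lam th t k j = 1 := by
  have hm' : (0 : ℝ) < m := by exact_mod_cast hm
  have hn' : (n : ℝ) = 2 * m := by exact_mod_cast hn
  have hs : ∀ s t : ℝ, ∑ k, (if y k = y j then s else t) = m * s + m * t := by
    intro s t
    simpa only [eq_comm] using sum_ite_sameBlock hn hy j s t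
  simp only [blockKernel, Matrix.of_apply, Finset.sum_add_distrib, ← Finset.mul_sum,
    ← Finset.sum_div, Finset.sum_sub_distrib, hs, Finset.sum_ite_eq', Finset.mem_univ, if_true,
    Finset.sum_const, Finset.card_univ, Fintype.card_fin, nsmul_eq_mul]
  rw [hn']
  field_simp
  ring

theorem sum_sameBlock_blockKernel {n m : ℕ} (hm : 1 ≤ m) (hn : n = 2 * m) {y : Fin n → Fin 2}
    (hy : ∀ c : Fin 2, (Finset.univ.filter fun i => y i = c).card = m) (lam th : ℝ) (t : ℕ)
    (i j : Fin n) : ∑ k, (if y i = y k then 1 else 0) * blockKernel m y lam th t k j =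
      m * (1 / n + lam ^ t * (if y i = y j then 1 else -1) / n) := by
  have hm' : (0 : ℝ) < m := by exact_mod_cast hm
  have hn' : (n : ℝ) = 2 * m := by exact_mod_cast hn
  have h1 : ∑ k, (if y i = y k then (1 : ℝ) else 0) = m := by
    simpa using sum_ite_sameBlock hn hy i 1 0
  have h2 := sum_sameBlock_mul hy i j (1 : ℝ) (-1)
  have h3 := sum_sameBlock_mul hy i j ((1 : ℝ) / m) 0
  have h4 : ∀ k, (if y i = y k then (1 : ℝ) else 0) * blockKernel m y lam th t k j =
      (if y i = y k then 1 else 0) * (1 / n) +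
      lam ^ t / n * ((if y i = y k then 1 else 0) * (if y k = y j then 1 else -1)) +
      (-th) ^ t * ((if k = j then (if y i = y k then 1 else 0) else 0) -
        (if y i = y k then 1 else 0) * (if y k = y j then 1 / (m : ℝ) else 0)) := by
    intro k
    simp only [blockKernel, Matrix.of_apply]
    by_cases hk : k = j
    · simp only [hk, if_true]; ring
    · simp only [hk, if_false]; ring
  rw [Finset.sum_congr rfl fun k _ => h4 k]
  simp only [Finset.sum_add_distrib, ← Finset.mul_sum, ← Finset.sum_mul, Finset.sum_sub_distrib]
  rw [h1, h2, h3, Finset.sum_ite_eq', if_pos (Finset.mem_univ _)]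
  have h5 : (if y i = y j then (1 : ℝ) else 0) - m * (if y i = y j then 1 / (m : ℝ) else 0) = 0 := by
    split_ifs
    · field_simp; ring
    · simp
  rw [h5]
  ring

/-- The expected graph has edge weights `a` within and `b` across communities and no loops, hence
constant degree `(m - 1) a + m b`. -/
theorem naturalWalk_apply_sbm {n m : ℕ} (hn : n = 2 * m) {y : Fin n → Fin 2}
    (hy : ∀ c : Fin 2, (Finset.univ.filter fun i => y i = c).card = m) {a b : ℝ}
    {Ω : Type*} [MeasurableSpace Ω] {μ : Measure Ω}
    {G : Ω → SimpleGraph (Fin n)} (hG : IsSBM μ G y !![a, b; b, a]) (i j : Fin n) :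
    naturalWalk (expectedAdj μ G) i j =
      ((if y i = y j then a else b) - if i = j then a else 0) / ((m - 1) * a + m * b) := by
  have hA : ∀ i j, expectedAdj μ G i j = (if y i = y j then a else b) - if i = j then a else 0 := by
    intro i j
    rw [expectedAdj_apply hG]
    by_cases hij : i = j
    · subst hij; simp
    · simp only [hij, if_false, sub_zero]
      generalize y i = p
      generalize y j = q
      fin_cases p <;> fin_cases q <;> simp
  simp only [naturalWalk, Matrix.of_apply, hA, Finset.sum_sub_distrib, sum_ite_sameBlock hn hy,
    Finset.sum_ite_eq, Finset.mem_univ, if_true]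
  congr 1
  ring

/-- The spectral form of the powers of the transition matrix; `D` is the degree. -/
theorem pow_eq_blockKernel {n m : ℕ} (hm : 1 ≤ m) (hn : n = 2 * m) {y : Fin n → Fin 2}
    (hy : ∀ c : Fin 2, (Finset.univ.filter fun i => y i = c).card = m) {a b D : ℝ}
    (hD : D = (m - 1) * a + m * b) (hD0 : D ≠ 0)
    {W : Matrix (Fin n) (Fin n) ℝ}
    (hW : ∀ i j, W i j = ((if y i = y j then a else b) - if i = j then a else 0) / D) (t : ℕ) :
    W ^ t = blockKernel m y (((m - 1) * a - m * b) / D) (a / D) t := by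
  have hm' : (0 : ℝ) < m := by exact_mod_cast hm
  have hn' : (n : ℝ) = 2 * m := by exact_mod_cast hn
  set lam := ((m - 1) * a - m * b) / D with hlam
  set th := a / D with hth
  induction t with
  | zero =>
    ext i j
    simp only [pow_zero, blockKernel, Matrix.of_apply, Matrix.one_apply, hn']
    split_ifs <;> field_simp <;> ring
  | succ t ih =>
    rw [pow_succ', ih]
    ext i j
    rw [Matrix.mul_apply]
    have hrow : ∀ k, W i k * blockKernel m y lam th t k j =
        (a - b) / D * ((if y i = y k then 1 else 0) * blockKernel m y lam th t k j) +
        b / D * blockKernel m y lam th t k j -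
        if i = k then a / D * blockKernel m y lam th t k j else 0 := by
      intro k
      rw [hW]
      split_ifs <;> ring
    rw [Finset.sum_congr rfl fun k _ => hrow k, Finset.sum_sub_distrib, Finset.sum_add_distrib,
      ← Finset.mul_sum, ← Finset.mul_sum, sum_sameBlock_blockKernel hm hn hy,
      sum_blockKernel_left hm hn hy, Finset.sum_ite_eq, if_pos (Finset.mem_univ _)]
    -- the eigenvalue relations on the constant and on the `±1` vector
    have e1 : (a - b) / D * m + b / D * n - a / D = 1 := by
      rw [hn']; field_simp; rw [hD]; ring
    have e2 : (a - b) / D * m - a / D = lam := by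
      rw [hlam]; field_simp; ring
    simp only [blockKernel, Matrix.of_apply, pow_succ]
    have hn0 : (n : ℝ) ≠ 0 := by rw [hn']; positivity
    have e1' : (a - b) / D * m * (1 / n) + b / D - a / D * (1 / n) = 1 / n := by
      field_simp; field_simp at e1; linarith
    rw [← hth]
    rw [← hth] at e1' e2
    linear_combination e1' + (lam ^ t * (if y i = y j then 1 else -1) / n) * e2

/-! ### Exponential moments and almost sure averages -/

theorem comp_eq_sum_indicator {Ω α : Type*} [Fintype α] (Y : Ω → α) (h : α → ℝ) :
    (fun ω => h (Y ω)) = fun ω => ∑ x, h x * {ω | Y ω = x}.indicator 1 ω := by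
  classical
  ext ω
  simp [Set.indicator, Finset.sum_ite_eq]

theorem integrable_comp_of_finite {Ω α : Type*} [MeasurableSpace Ω] {P : Measure Ω}
    [IsFiniteMeasure P] [Fintype α] {Y : Ω → α} (hY : ∀ x, MeasurableSet {ω | Y ω = x})
    (h : α → ℝ) : Integrable (fun ω => h (Y ω)) P := by
  rw [comp_eq_sum_indicator]
  exact integrable_finsetSum _ fun x _ =>
    ((integrable_const (1 : ℝ)).indicator (hY x)).const_mul _

theorem integral_comp_of_finite {Ω α : Type*} [MeasurableSpace Ω] {P : Measure Ω}
    [IsFiniteMeasure P] [Fintype α] {Y : Ω → α} (hY : ∀ x, MeasurableSet {ω | Y ω = x})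
    (h : α → ℝ) : ∫ ω, h (Y ω) ∂P = ∑ x, P.real {ω | Y ω = x} * h x := by
  rw [comp_eq_sum_indicator, integral_finsetSum]
  · refine Finset.sum_congr rfl fun x _ => ?_
    rw [integral_const_mul, integral_indicator_one (hY x), mul_comm]
  · exact fun x _ => ((integrable_const (1 : ℝ)).indicator (hY x)).const_mul _

/-- Conditioning on `Y`, in finite form: if `q x` is the law of `U` given `Y = x`, a factor with
conditional expectation at most `K` costs at most the factor `K`. -/
theorem integral_mul_le_of_conditional {Ω α β : Type*} [MeasurableSpace Ω] {P : Measure Ω}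
    [IsFiniteMeasure P] [Fintype α] [Fintype β] {Y : Ω → α} {U : Ω → β}
    (hY : ∀ x, MeasurableSet {ω | Y ω = x}) (hU : ∀ u, MeasurableSet {ω | U ω = u})
    (q : α → β → ℝ) (hq : ∀ x u, P.real {ω | Y ω = x ∧ U ω = u} = P.real {ω | Y ω = x} * q x u)
    {f : α → ℝ} (hf : ∀ x, 0 ≤ f x) {g : α → β → ℝ} {K : ℝ} (hK : ∀ x, ∑ u, q x u * g x u ≤ K) :
    ∫ ω, f (Y ω) * g (Y ω) (U ω) ∂P ≤ K * ∫ ω, f (Y ω) ∂P := by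
  have hYU : ∀ z : α × β, MeasurableSet {ω | (Y ω, U ω) = z} := by
    rintro ⟨x, u⟩
    simpa only [Prod.mk.injEq, Set.ofPred_and] using (hY x).inter (hU u)
  rw [integral_comp_of_finite (Y := fun ω => (Y ω, U ω)) hYU (fun z => f z.1 * g z.1 z.2),
    integral_comp_of_finite hY, Fintype.sum_prod_type, Finset.mul_sum]
  refine Finset.sum_le_sum fun x _ => ?_
  have : ∀ u, P.real {ω | (Y ω, U ω) = (x, u)} * (f x * g x u) =
      (P.real {ω | Y ω = x} * f x) * (q x u * g x u) := by
    intro u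
    simp only [Prod.mk.injEq]
    rw [hq]; ring
  rw [Finset.sum_congr rfl fun u _ => this u, ← Finset.mul_sum, mul_comm K]
  exact mul_le_mul_of_nonneg_left (hK x) (mul_nonneg measureReal_nonneg (hf x))

/-- The exponential moment of a centred indicator, from `exp x ≤ 1 + x + x ^ 2` for `|x| ≤ 1`. -/
theorem sum_mul_exp_centered_le {V : Type*} [Fintype V] [DecidableEq V] {u : V → ℝ}
    (hu : ∀ a, 0 ≤ u a) (hu1 : ∑ a, u a = 1) (j : V) {θ c : ℝ} (hθ : |θ| ≤ 1) (hc : |c| ≤ 1) :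
    ∑ a, u a * Real.exp (θ * (c * ((if a = j then 1 else 0) - u j))) ≤ Real.exp (θ ^ 2) := by
  have huj1 : u j ≤ 1 := hu1 ▸ Finset.single_le_sum (fun a _ => hu a) (Finset.mem_univ j)
  have hbound : ∀ a, Real.exp (θ * (c * ((if a = j then 1 else 0) - u j))) ≤
      1 + θ * (c * ((if a = j then 1 else 0) - u j)) + θ ^ 2 := by
    intro a
    set d : ℝ := (if a = j then 1 else 0) - u j with hd
    have hd1 : |d| ≤ 1 := by
      have := hu j
      rw [hd, abs_le]; split_ifs <;> constructor <;> linarith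
    have hcd : |c * d| ≤ 1 := by
      rw [abs_mul]; exact mul_le_one₀ hc (abs_nonneg _) hd1
    have hx : |θ * (c * d)| ≤ 1 := by
      rw [abs_mul]; exact mul_le_one₀ hθ (abs_nonneg _) hcd
    have h1 := (abs_le.1 (Real.abs_exp_sub_one_sub_id_le hx)).2
    have h2 : (θ * (c * d)) ^ 2 ≤ θ ^ 2 := by
      rw [mul_pow]
      exact mul_le_of_le_one_right (sq_nonneg _) ((sq_le_one_iff_abs_le_one _).2 hcd)
    linarith
  calc ∑ a, u a * Real.exp (θ * (c * ((if a = j then 1 else 0) - u j)))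
      ≤ ∑ a, u a * (1 + θ * (c * ((if a = j then 1 else 0) - u j)) + θ ^ 2) :=
        Finset.sum_le_sum fun a _ => mul_le_mul_of_nonneg_left (hbound a) (hu a)
    _ = ∑ a, ((1 - θ * c * u j + θ ^ 2) * u a + θ * c * (if a = j then u a else 0)) := by
        refine Finset.sum_congr rfl fun a _ => ?_
        split_ifs <;> ring
    _ = 1 + θ ^ 2 := by
        rw [Finset.sum_add_distrib, ← Finset.mul_sum, ← Finset.mul_sum, hu1, Finset.sum_ite_eq',
          if_pos (Finset.mem_univ _)]
        ring
    _ ≤ Real.exp (θ ^ 2) := by linarith [Real.add_one_le_exp (θ ^ 2)]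

/-- A sequence whose exponential moments are sub-Gaussian with variance proxy linear in `N` is
almost surely `o(N)`, by Chernoff bounds and the Borel-Cantelli lemma. No relation between the
variables for different `N` is needed. -/
theorem ae_tendsto_div_zero_of_exp_moment {Ω : Type*} [MeasurableSpace Ω] {P : Measure Ω}
    [IsProbabilityMeasure P] {S : ℕ → Ω → ℝ} {C : ℝ} (hC : 0 < C)
    (hint : ∀ N θ, Integrable (fun ω => Real.exp (θ * S N ω)) P)
    (hmgf : ∀ N, 1 ≤ N → ∀ θ : ℝ, |θ| ≤ 1 →
      ∫ ω, Real.exp (θ * S N ω) ∂P ≤ Real.exp (θ ^ 2 * (C * N))) :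
    ∀ᵐ ω ∂P, Tendsto (fun N => S N ω / N) atTop (𝓝 0) := by
  have key : ∀ ε : ℝ, 0 < ε → ∀ᵐ ω ∂P, ∀ᶠ N in atTop, |S N ω| < ε * N := by
    intro ε hε
    -- with this `θ` the Chernoff exponent `θ ^ 2 C - θ ε` is at most `-θ ε / 2`
    obtain ⟨θ, hθ0, hθ1, hθε⟩ : ∃ θ : ℝ, 0 < θ ∧ θ ≤ 1 ∧ θ * C ≤ ε / 2 :=
      ⟨min 1 (ε / 2 / C), by positivity, min_le_left _ _,
        by rw [← le_div_iff₀ hC]; exact min_le_right _ _⟩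
    set ρ := Real.exp (-(θ * ε / 2)) with hρ
    have hρ1 : ρ < 1 := by rw [hρ, Real.exp_lt_one_iff]; linarith [mul_pos hθ0 hε]
    have hbound : ∀ N : ℕ, 1 ≤ N →
        Real.exp (-(θ * (ε * N))) * Real.exp (θ ^ 2 * (C * N)) ≤ ρ ^ N := by
      intro N _
      rw [← Real.exp_add, hρ, ← Real.exp_nat_mul, Real.exp_le_exp]
      have : θ * (θ * C) * N ≤ θ * (ε / 2) * N := by gcongr
      nlinarith
    have hup : ∀ N : ℕ, 1 ≤ N → P.real {ω | ε * N ≤ S N ω} ≤ ρ ^ N := by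
      intro N hN
      have h := measure_ge_le_exp_mul_mgf (ε * N) hθ0.le (hint N θ)
      refine (h.trans ?_).trans (hbound N hN)
      rw [neg_mul]
      gcongr
      exact hmgf N hN θ (by rw [abs_of_pos hθ0]; exact hθ1)
    have hdown : ∀ N : ℕ, 1 ≤ N → P.real {ω | S N ω ≤ -(ε * N)} ≤ ρ ^ N := by
      intro N hN
      have h := measure_le_le_exp_mul_mgf (-(ε * N)) (neg_nonpos.2 hθ0.le) (hint N (-θ))
      refine (h.trans ?_).trans (hbound N hN)
      rw [neg_neg, mul_neg]
      gcongr
      have := hmgf N hN (-θ) (by rw [abs_neg, abs_of_pos hθ0]; exact hθ1)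
      rwa [neg_sq] at this
    have hB : ∀ N : ℕ, P {ω | ¬ |S N ω| < ε * N} ≤ ENNReal.ofReal (2 * ρ ^ N) := by
      intro N
      rcases Nat.eq_zero_or_pos N with rfl | hN
      · exact prob_le_one.trans (by simp)
      · rw [← ofReal_measureReal]
        refine ENNReal.ofReal_le_ofReal ?_
        have hsub : {ω | ¬ |S N ω| < ε * N} ⊆ {ω | ε * N ≤ S N ω} ∪ {ω | S N ω ≤ -(ε * N)} := by
          intro ω hω
          simp only [Set.mem_ofPred_eq, not_lt, le_abs] at hω
          rcases hω with h | h
          · exact Or.inl h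
          · exact Or.inr (by simp only [Set.mem_ofPred_eq]; linarith)
        refine (measureReal_mono hsub).trans ((measureReal_union_le _ _).trans ?_)
        linarith [hup N hN, hdown N hN]
    have hsum : ∑' N : ℕ, P {ω | ¬ |S N ω| < ε * N} ≠ ⊤ := by
      have hs : Summable fun N : ℕ => 2 * ρ ^ N :=
        (summable_geometric_of_lt_one (Real.exp_pos _).le hρ1).mul_left 2
      refine ne_top_of_le_ne_top ?_ (ENNReal.tsum_le_tsum hB)
      rw [← ENNReal.ofReal_tsum_of_nonneg (fun N => by positivity) hs]
      exact ENNReal.ofReal_ne_top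
    filter_upwards [ae_eventually_notMem hsum] with ω hω
    filter_upwards [hω] with N hN
    simpa using hN
  have hall : ∀ᵐ ω ∂P, ∀ k : ℕ, ∀ᶠ N in atTop, |S N ω| < 1 / ((k : ℝ) + 1) * N :=
    ae_all_iff.2 fun k => key _ (by positivity)
  filter_upwards [hall] with ω hω
  rw [Metric.tendsto_atTop']
  intro ε hε
  obtain ⟨k, hk⟩ := exists_nat_one_div_lt hε
  obtain ⟨N₀, hN₀⟩ := eventually_atTop.1 (hω k)
  refine ⟨N₀, fun N hN => ?_⟩
  have hNpos : (0 : ℝ) < N := by exact_mod_cast (Nat.zero_le N₀).trans_lt hN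
  rw [Real.dist_eq, sub_zero, abs_div, abs_of_pos hNpos, div_lt_iff₀ hNpos]
  exact (hN₀ N hN.le).trans (mul_lt_mul_of_pos_right hk hNpos)

/-! ### A single random walk -/

/-- The path that follows `p` at the times `0, …, N` and stays put afterwards. -/
def stoppedPath {V : Type*} {N : ℕ} (p : Fin (N + 1) → V) : ℕ → V :=
  fun s => p ⟨min s N, by omega⟩

theorem stoppedPath_apply {V : Type*} {N : ℕ} (p : Fin (N + 1) → V) {s : ℕ} (hs : s < N + 1) :
    stoppedPath p s = p ⟨s, hs⟩ := by
  simp only [stoppedPath]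
  congr 2
  omega

theorem stoppedPath_history {V : Type*} (x : ℕ → V) {N s : ℕ} (hs : s < N + 1) :
    stoppedPath (fun u : Fin (N + 1) => x u) s = x s := stoppedPath_apply _ hs

theorem history_eq_iff {V : Type*} (x : ℕ → V) {N : ℕ} (p : Fin (N + 1) → V) :
    (fun u : Fin (N + 1) => x u) = p ↔ ∀ s < N + 1, x s = stoppedPath p s := by
  constructor
  · rintro rfl s hs
    rw [stoppedPath_history x hs]
  · intro h
    ext u
    rw [h u u.2, stoppedPath_apply p u.2]

section Walk

variable {V : Type*} [DecidableEq V]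

theorem walkProb_congr (W : Matrix V V ℝ) (v : V) {ℓ : ℕ} (hℓ : 1 ≤ ℓ) {x x' : ℕ → V}
    (h : ∀ s < ℓ, x s = x' s) : walkProb W v ℓ x = walkProb W v ℓ x' := by
  unfold walkProb
  rw [h 0 hℓ]
  congr 1
  refine Finset.prod_congr rfl fun s hs => ?_
  have := Finset.mem_range.1 hs
  rw [h s (by omega), h (s + 1) (by omega)]

theorem walkProb_succ (W : Matrix V V ℝ) (v : V) (N : ℕ) (x : ℕ → V) :
    walkProb W v (N + 2) x = walkProb W v (N + 1) x * W (x N) (x (N + 1)) := by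
  simp only [walkProb, Nat.add_sub_cancel]
  rw [show N + 2 - 1 = N + 1 by omega, Finset.prod_range_succ, mul_assoc]

theorem sum_walkProb_stoppedPath [Fintype V] {W : Matrix V V ℝ} (hrow : ∀ i, ∑ j, W i j = 1) (v : V)
    (N : ℕ) : ∑ p : Fin (N + 1) → V, walkProb W v (N + 1) (stoppedPath p) = 1 := by
  induction N with
  | zero =>
    rw [Fintype.sum_equiv (Equiv.funUnique (Fin 1) V) _ (fun u => if u = v then (1 : ℝ) else 0)]
    · simp
    · intro p
      simp [walkProb, stoppedPath]
  | succ N ih =>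
    rw [← Fintype.sum_equiv (Fin.snocEquiv fun _ : Fin (N + 2) => V)
      (fun q => walkProb W v (N + 1) (stoppedPath q.2) * W (q.2 (Fin.last N)) q.1),
      Fintype.sum_prod_type, Finset.sum_comm]
    · simp only [← Finset.mul_sum, hrow, mul_one]
      exact ih
    · rintro ⟨u, p⟩
      have h1 : ∀ s < N + 1, stoppedPath (Fin.snoc (α := fun _ => V) p u) s = stoppedPath p s := by
        intro s hs
        rw [stoppedPath_apply _ (by omega), stoppedPath_apply _ hs]
        exact Fin.snoc_castSucc (α := fun _ => V) u p ⟨s, hs⟩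
      have h2 : stoppedPath (Fin.snoc (α := fun _ => V) p u) (N + 1) = u := by
        rw [stoppedPath_apply _ (by omega)]
        exact Fin.snoc_last (α := fun _ => V) u p
      have e : Fin.snocEquiv (fun _ : Fin (N + 2) => V) (u, p) =
          Fin.snoc (α := fun _ => V) p u := rfl
      rw [e, walkProb_succ, h2, walkProb_congr W v (by omega) h1, h1 N (by omega),
        stoppedPath_apply p (by omega)]
      rfl

/-- `x` is a Markov chain with transition matrix `W` started at `v`. -/
structure IsWalkFrom {Ω : Type*} [MeasurableSpace Ω] (P : Measure Ω) (W : Matrix V V ℝ) (v : V)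
    (x : Ω → ℕ → V) : Prop where
  measurable : ∀ s i, MeasurableSet {ω | x ω s = i}
  law : ∀ ℓ, 1 ≤ ℓ → ∀ p : ℕ → V, P.real {ω | ∀ s < ℓ, x ω s = p s} = walkProb W v ℓ p

theorem measurableSet_pi_eq {Ω ι : Type*} [MeasurableSpace Ω] [Finite ι] {β : Type*}
    {Y : Ω → ι → β} (h : ∀ u b, MeasurableSet {ω | Y ω u = b}) (p : ι → β) :
    MeasurableSet {ω | Y ω = p} := by
  have : {ω | Y ω = p} = ⋂ u, {ω | Y ω u = p u} := by
    ext ω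
    simp [funext_iff]
  rw [this]
  exact MeasurableSet.iInter fun u => h u _

namespace IsWalkFrom

variable {Ω : Type*} [MeasurableSpace Ω] {P : Measure Ω} {W : Matrix V V ℝ} {v : V}
  {x : Ω → ℕ → V}

theorem measurable_history (h : IsWalkFrom P W v x) (N : ℕ) (p : Fin (N + 1) → V) :
    MeasurableSet {ω | (fun s : Fin (N + 1) => x ω s) = p} :=
  measurableSet_pi_eq (Y := fun ω (s : Fin (N + 1)) => x ω s) (fun u b => h.measurable u b) p

/-- The Markov property. -/
theorem history_succ (h : IsWalkFrom P W v x) (N : ℕ) (p : Fin (N + 1) → V) (u : V) :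
    P.real {ω | (fun s : Fin (N + 1) => x ω s) = p ∧ x ω (N + 1) = u} =
      P.real {ω | (fun s : Fin (N + 1) => x ω s) = p} * W (stoppedPath p N) u := by
  set q : ℕ → V := fun s => if s ≤ N then stoppedPath p s else u with hq
  have hq1 : ∀ s < N + 1, q s = stoppedPath p s := fun s hs => by
    simp only [hq]; rw [if_pos (by omega)]
  have hq2 : q (N + 1) = u := by simp only [hq]; rw [if_neg (by omega)]
  have e1 : {ω | (fun s : Fin (N + 1) => x ω s) = p} = {ω | ∀ s < N + 1, x ω s = q s} := by
    ext ω
    simp only [Set.mem_ofPred_eq, history_eq_iff]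
    exact forall₂_congr fun s hs => by rw [hq1 s hs]
  have e2 : {ω | (fun s : Fin (N + 1) => x ω s) = p ∧ x ω (N + 1) = u} =
      {ω | ∀ s < N + 2, x ω s = q s} := by
    ext ω
    simp only [Set.mem_ofPred_eq, history_eq_iff]
    constructor
    · rintro ⟨h1, h2⟩ s hs
      rcases Nat.lt_succ_iff_lt_or_eq.1 hs with hs | rfl
      · rw [h1 s hs, hq1 s hs]
      · rw [h2, hq2]
    · intro h1
      exact ⟨fun s hs => by rw [h1 s (by omega), hq1 s hs], by rw [h1 _ (by omega), hq2]⟩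
  rw [e1, e2, h.law _ (by omega), h.law _ (by omega), walkProb_succ, hq2, hq1 N (by omega)]

theorem ae_start [IsProbabilityMeasure P] (h : IsWalkFrom P W v x) : ∀ᵐ ω ∂P, x ω 0 = v := by
  have hm := h.measurable 0 v
  have h1 : P.real {ω | x ω 0 = v} = 1 := by
    have := h.law 1 le_rfl fun _ => v
    simpa [walkProb] using this
  have h2 : P.real {ω | x ω 0 = v}ᶜ = 0 := by rw [probReal_compl_eq_one_sub hm, h1, sub_self]
  rw [measureReal_eq_zero_iff] at h2
  exact h2

/-- Almost surely the walk makes no step of probability zero. -/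
theorem ae_step_ne_zero [Finite V] [IsProbabilityMeasure P] (h : IsWalkFrom P W v x) :
    ∀ᵐ ω ∂P, ∀ N, W (x ω N) (x ω (N + 1)) ≠ 0 := by
  rw [ae_all_iff]
  intro N
  have hzero : ∀ (p : Fin (N + 1) → V) (u : V), W (stoppedPath p N) u = 0 →
      ∀ᵐ ω ∂P, ¬ ((fun s : Fin (N + 1) => x ω s) = p ∧ x ω (N + 1) = u) := by
    intro p u hpu
    have := h.history_succ N p u
    rw [hpu, mul_zero, measureReal_eq_zero_iff] at this
    rw [ae_iff]
    simpa using this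
  have hall : ∀ᵐ ω ∂P, ∀ (p : Fin (N + 1) → V) (u : V), W (stoppedPath p N) u = 0 →
      ¬ ((fun s : Fin (N + 1) => x ω s) = p ∧ x ω (N + 1) = u) := by
    simp only [ae_all_iff]
    exact hzero
  filter_upwards [hall] with ω hω h0
  refine hω (fun s : Fin (N + 1) => x ω s) (x ω (N + 1)) ?_ ⟨rfl, rfl⟩
  rwa [stoppedPath_history _ (by omega)]

end IsWalkFrom

/-- The sum up to time `N` of the centred indicators of a step to `j`, taken at the times at which
the walk was at `i` exactly `t` steps earlier. -/
def innovationSum (W : Matrix V V ℝ) (x : ℕ → V) (t : ℕ) (i j : V) (N : ℕ) : ℝ :=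
  ∑ s ∈ Finset.range N, (if t ≤ s ∧ x (s - t) = i then 1 else 0) *
    ((if x (s + 1) = j then 1 else 0) - W (x s) j)

theorem innovationSum_congr (W : Matrix V V ℝ) {x x' : ℕ → V} (t : ℕ) (i j : V) {N : ℕ}
    (h : ∀ s < N + 1, x s = x' s) : innovationSum W x t i j N = innovationSum W x' t i j N := by
  refine Finset.sum_congr rfl fun s hs => ?_
  have := Finset.mem_range.1 hs
  rw [h s (by omega), h (s + 1) (by omega), h (s - t) (by omega)]

namespace IsWalkFrom

variable {Ω : Type*} [MeasurableSpace Ω] {P : Measure Ω} [IsProbabilityMeasure P]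
  [Fintype V] {W : Matrix V V ℝ} {v : V} {x : Ω → ℕ → V}

theorem integrable_exp_innovationSum (h : IsWalkFrom P W v x) (t : ℕ) (i j : V) (N : ℕ) (θ : ℝ) :
    Integrable (fun ω => Real.exp (θ * innovationSum W (x ω) t i j N)) P := by
  have := integrable_comp_of_finite (P := P) (h.measurable_history N)
    fun p => Real.exp (θ * innovationSum W (stoppedPath p) t i j N)
  refine this.congr (Eventually.of_forall fun ω => ?_)
  beta_reduce
  rw [innovationSum_congr W t i j fun s hs => stoppedPath_history (x ω) hs]

/-- By induction on `N`: given the walk up to time `N`, the next summand is a centred indicator, or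
zero. -/
theorem integral_exp_innovationSum_le (h : IsWalkFrom P W v x) (hW : ∀ i j, 0 ≤ W i j)
    (hrow : ∀ i, ∑ j, W i j = 1) (t : ℕ) (i j : V) {θ : ℝ} (hθ : |θ| ≤ 1) (N : ℕ) :
    ∫ ω, Real.exp (θ * innovationSum W (x ω) t i j N) ∂P ≤ Real.exp (θ ^ 2 * N) := by
  induction N with
  | zero => simp [innovationSum]
  | succ N ih =>
    set c : (ℕ → V) → ℝ := fun y => if t ≤ N ∧ y (N - t) = i then 1 else 0 with hc
    have hstep := integral_mul_le_of_conditional (P := P) (h.measurable_history N)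
      (h.measurable (N + 1)) (fun p u => W (stoppedPath p N) u) (h.history_succ N)
      (f := fun p => Real.exp (θ * innovationSum W (stoppedPath p) t i j N))
      (g := fun p u => Real.exp (θ * (c (stoppedPath p) *
        ((if u = j then 1 else 0) - W (stoppedPath p N) j))))
      (K := Real.exp (θ ^ 2)) (fun p => (Real.exp_pos _).le)
      (fun p => sum_mul_exp_centered_le (hW _) (hrow _) j hθ
        (by simp only [hc]; split_ifs <;> simp))
    have e1 : ∀ ω, innovationSum W (stoppedPath fun s : Fin (N + 1) => x ω s) t i j N =
        innovationSum W (x ω) t i j N := fun ω =>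
      innovationSum_congr W t i j fun s hs => stoppedPath_history (x ω) hs
    have e2 : ∀ ω, c (stoppedPath fun s : Fin (N + 1) => x ω s) = c (x ω) := fun ω => by
      simp only [hc]; rw [stoppedPath_history _ (by omega)]
    have e3 : ∀ ω, stoppedPath (fun s : Fin (N + 1) => x ω s) N = x ω N := fun ω =>
      stoppedPath_history _ (by omega)
    simp only [e1, e2, e3, ← Real.exp_add, ← mul_add] at hstep
    have e4 : ∀ ω, innovationSum W (x ω) t i j (N + 1) = innovationSum W (x ω) t i j N +
        c (x ω) * ((if x ω (N + 1) = j then 1 else 0) - W (x ω N) j) := fun ω => by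
      rw [innovationSum, Finset.sum_range_succ]; rfl
    simp only [e4]
    refine hstep.trans ((mul_le_mul_of_nonneg_left ih (Real.exp_pos _).le).trans_eq ?_)
    rw [← Real.exp_add]
    push_cast
    ring_nf

theorem ae_tendsto_innovationSum (h : IsWalkFrom P W v x) (hW : ∀ i j, 0 ≤ W i j)
    (hrow : ∀ i, ∑ j, W i j = 1) (t : ℕ) (i j : V) :
    ∀ᵐ ω ∂P, Tendsto (fun N => innovationSum W (x ω) t i j N / N) atTop (𝓝 0) :=
  ae_tendsto_div_zero_of_exp_moment one_pos
    (fun N θ => h.integrable_exp_innovationSum t i j N θ)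
    (fun N _ θ hθ => by simpa using h.integral_exp_innovationSum_le hW hrow t i j hθ N)

end IsWalkFrom

end Walk

/-! ### Marginal laws and negative samples -/

theorem sum_prod_eq_prod_sum {ι β : Type*} [Fintype ι] [DecidableEq ι] [Fintype β]
    (φ : ι → β → ℝ) : ∑ z : ι → β, ∏ q, φ q (z q) = ∏ q, ∑ a, φ q a := by
  rw [Finset.prod_univ_sum, Fintype.piFinset_univ]

theorem sum_prod_prod_eq_prod_prod_sum {ι κ β : Type*} [Fintype ι] [DecidableEq ι] [Fintype κ]
    [DecidableEq κ] [Fintype β] (φ : ι → κ → β → ℝ) :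
    ∑ z : ι → κ → β, ∏ v, ∏ p, φ v p (z v p) = ∏ v, ∏ p, ∑ a, φ v p a := by
  rw [sum_prod_eq_prod_sum (fun v (z : κ → β) => ∏ p, φ v p (z p))]
  simp only [sum_prod_eq_prod_sum]

theorem measureReal_preimage_eq_sum {Ω α : Type*} [MeasurableSpace Ω] {P : Measure Ω}
    [IsFiniteMeasure P] [Fintype α] {Y : Ω → α} (hY : ∀ x, MeasurableSet {ω | Y ω = x})
    (S : α → Prop) [DecidablePred S] :
    P.real {ω | S (Y ω)} = ∑ x, if S x then P.real {ω | Y ω = x} else 0 := by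
  have hS : MeasurableSet {ω | S (Y ω)} := by
    have : {ω | S (Y ω)} = ⋃ x ∈ {x | S x}, {ω | Y ω = x} := by
      ext ω; simp
    rw [this]
    exact MeasurableSet.biUnion (Set.to_countable _) fun x _ => hY x
  have h := integral_comp_of_finite (P := P) hY fun x => if S x then 1 else 0
  rw [← integral_indicator_one hS]
  simp only [mul_ite, mul_one, mul_zero] at h
  rw [← h]
  congr 1
  ext ω
  simp [Set.indicator]

section Sampling

variable {V : Type*} [Fintype V] [DecidableEq V] {r : ℕ}

/-- The walks up to time `N`. -/
def walkHistory (N : ℕ) (x : WalkFamily V r) : V → Fin r → Fin (N + 1) → V :=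
  fun v p s => x v p s

/-- The walks that follow `h` at the times `0, …, N` and stay put afterwards. -/
def stoppedFamily {N : ℕ} (h : V → Fin r → Fin (N + 1) → V) : WalkFamily V r :=
  fun v p => stoppedPath (h v p)

omit [Fintype V] [DecidableEq V] in
theorem walkHistory_eq_iff {N : ℕ} (x : WalkFamily V r) (h : V → Fin r → Fin (N + 1) → V) :
    walkHistory N x = h ↔ ∀ v p, ∀ s < N + 1, x v p s = stoppedFamily h v p s := by
  simp only [funext_iff (f := walkHistory N x), funext_iff (f := walkHistory N x _)]
  exact forall₂_congr fun v p => history_eq_iff (x v p) (h v p)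

theorem unigram_nonneg (x : WalkFamily V r) (ℓ : ℕ) (j : V) : 0 ≤ unigram x ℓ j := by
  unfold unigram
  positivity

theorem sum_unigram [Nonempty V] (hr : 1 ≤ r) (x : WalkFamily V r) {ℓ : ℕ} (hℓ : 1 ≤ ℓ) :
    ∑ j, unigram x ℓ j = 1 := by
  have hcard := Fintype.card_congr
    (Equiv.sigmaFiberEquiv fun q : V × Fin r × Fin ℓ => x q.1 q.2.1 q.2.2)
  rw [Fintype.card_sigma, Fintype.card_prod, Fintype.card_prod, Fintype.card_fin,
    Fintype.card_fin] at hcard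
  have hV : (0 : ℝ) < Fintype.card V := by exact_mod_cast Fintype.card_pos
  have hr' : (0 : ℝ) < r := by exact_mod_cast hr
  have hl' : (0 : ℝ) < ℓ := by exact_mod_cast hℓ
  simp only [unigram]
  rw [← Finset.sum_div, div_eq_one_iff_eq (by positivity)]
  rw [mul_assoc]
  exact_mod_cast hcard

theorem unigram_congr {x x' : WalkFamily V r} {ℓ : ℕ} (h : ∀ v p, ∀ s < ℓ, x v p s = x' v p s)
    (j : V) : unigram x ℓ j = unigram x' ℓ j := by
  have : ∀ q : V × Fin r × Fin ℓ, x q.1 q.2.1 q.2.2 = x' q.1 q.2.1 q.2.2 :=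
    fun q => h _ _ _ q.2.2.2
  simp only [unigram, this]

/-- The centred count of the negative pairs `(i, j)`. -/
noncomputable def negDeviation (x : WalkFamily V r) {w k ℓ : ℕ} (z : NegPosition V r w k ℓ → V)
    (i j : V) : ℝ :=
  ∑ q : NegPosition V r w k ℓ, (if x q.1.1 q.1.2.1 q.1.2.2.1.1 = i then 1 else 0) *
    ((if z q = j then 1 else 0) - unigram x ℓ j)

theorem negDeviation_congr {x x' : WalkFamily V r} {w k ℓ : ℕ}
    (h : ∀ v p, ∀ s < ℓ, x v p s = x' v p s) (z : NegPosition V r w k ℓ → V) (i j : V) :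
    negDeviation x z i j = negDeviation x' z i j := by
  refine Finset.sum_congr rfl fun q _ => ?_
  rw [h _ _ _ q.1.2.2.1.1.2, unigram_congr h]

/-- The positive pairs with first node `i`, of any second node. -/
theorem sum_posCount (x : WalkFamily V r) (w ℓ : ℕ) (i : V) :
    ∑ j, posCount x w ℓ i j =
      Fintype.card {q : V × Fin r × SkipPosition ℓ w // x q.1 q.2.1 q.2.2.1.1 = i} := by
  simp only [posCount, Fintype.card_subtype]
  rw [Finset.card_eq_sum_card_fiberwise (f := fun q : V × Fin r × SkipPosition ℓ w =>
    x q.1 q.2.1 q.2.2.1.2) (t := Finset.univ) (fun _ _ => Finset.mem_coe.2 (Finset.mem_univ _))]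
  simp only [Finset.filter_filter]

theorem negDeviation_eq (x : WalkFamily V r) {w k ℓ : ℕ} (z : NegPosition V r w k ℓ → V)
    (i j : V) : negDeviation x z i j =
      negCount x z i j - k * (∑ j', posCount x w ℓ i j' : ℕ) * unigram x ℓ j := by
  have h1 : (negCount x z i j : ℝ) = ∑ q : NegPosition V r w k ℓ,
      (if x q.1.1 q.1.2.1 q.1.2.2.1.1 = i then 1 else 0) * (if z q = j then 1 else 0) := by
    simp only [negCount, Fintype.card_subtype, Finset.card_filter, Nat.cast_sum, ite_and,
      ite_mul, one_mul, zero_mul]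
    push_cast
    rfl
  have h2 : (k : ℝ) * (∑ j', posCount x w ℓ i j' : ℕ) = ∑ q : NegPosition V r w k ℓ,
      if x q.1.1 q.1.2.1 q.1.2.2.1.1 = i then (1 : ℝ) else 0 := by
    rw [sum_posCount, Fintype.card_subtype, Finset.card_filter,
      Fintype.sum_prod_type (α₁ := V × Fin r × SkipPosition ℓ w) (α₂ := Fin k)]
    push_cast
    rw [Finset.mul_sum]
    refine Finset.sum_congr rfl fun q _ => ?_
    split_ifs <;> simp
  rw [h1, h2, Finset.sum_mul, ← Finset.sum_sub_distrib]
  exact Finset.sum_congr rfl fun q _ => mul_sub _ _ _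

theorem card_skipPosition_le (ℓ w : ℕ) : Fintype.card (SkipPosition ℓ w) ≤ ℓ * w := by
  have h := Fintype.card_le_of_injective
    (fun e : SkipPosition ℓ w => ((e.1.1, ⟨(e.1.2 : ℕ) - e.1.1 - 1, by
      have h1 : (e.1.1 : ℕ) < e.1.2 := e.2.1
      have h2 := e.2.2
      omega⟩) : Fin ℓ × Fin w)) (by
      rintro ⟨⟨a, b⟩, h1, h2⟩ ⟨⟨c, d⟩, h3, h4⟩ h
      have h1' : (a : ℕ) < b := h1
      have h3' : (c : ℕ) < d := h3
      simp only [Prod.mk.injEq, Fin.mk.injEq] at h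
      obtain ⟨rfl, h⟩ := h
      have : b = d := Fin.ext (by omega)
      subst this
      rfl)
  simpa using h

namespace IsVECSampling

variable {Ω : Type*} [MeasurableSpace Ω] {P : Measure Ω} [IsProbabilityMeasure P]
  {W : Matrix V V ℝ} {w k : ℕ} {X : Ω → WalkFamily V r}
  {Z : (ℓ : ℕ) → Ω → NegPosition V r w k ℓ → V}

omit [IsProbabilityMeasure P] in
theorem measurable_walkHistory (hXZ : IsVECSampling P W w k X Z) (N : ℕ)
    (h : V → Fin r → Fin (N + 1) → V) : MeasurableSet {ω | walkHistory N (X ω) = h} := by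
  refine measurableSet_pi_eq (Y := fun ω => walkHistory N (X ω)) (fun v b => ?_) h
  refine measurableSet_pi_eq (Y := fun ω => walkHistory N (X ω) v) (fun p b => ?_) b
  exact measurableSet_pi_eq (Y := fun ω => walkHistory N (X ω) v p)
    (fun s b => hXZ.measurable_walk v p s b) b

omit [IsProbabilityMeasure P] in
theorem measurable_sample (hXZ : IsVECSampling P W w k X Z) (ℓ : ℕ)
    (z : NegPosition V r w k ℓ → V) : MeasurableSet {ω | Z ℓ ω = z} :=
  measurableSet_pi_eq (hXZ.measurable_neg ℓ) z

omit [IsProbabilityMeasure P] in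
theorem joint_law (hXZ : IsVECSampling P W w k X Z) (N : ℕ) (h : V → Fin r → Fin (N + 1) → V)
    (z : NegPosition V r w k (N + 1) → V) :
    P.real {ω | walkHistory N (X ω) = h ∧ Z (N + 1) ω = z} =
      (∏ v, ∏ p, walkProb W v (N + 1) (stoppedPath (h v p))) *
        ∏ q, unigram (stoppedFamily h) (N + 1) (z q) := by
  simp only [walkHistory_eq_iff]
  exact hXZ.law (N + 1) (by omega) (stoppedFamily h) z

theorem walkHistory_law [Nonempty V] (hr : 1 ≤ r) (hXZ : IsVECSampling P W w k X Z) (N : ℕ)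
    (h : V → Fin r → Fin (N + 1) → V) :
    P.real {ω | walkHistory N (X ω) = h} =
      ∏ v, ∏ p, walkProb W v (N + 1) (stoppedPath (h v p)) := by
  have hYm : ∀ y : (V → Fin r → Fin (N + 1) → V) × (NegPosition V r w k (N + 1) → V),
      MeasurableSet {ω | (walkHistory N (X ω), Z (N + 1) ω) = y} := by
    rintro ⟨h, z⟩
    simpa only [Prod.mk.injEq, Set.ofPred_and] using
      (hXZ.measurable_walkHistory N h).inter (hXZ.measurable_sample (N + 1) z)
  have hsum := measureReal_preimage_eq_sum (P := P) hYm (fun y => y.1 = h)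
  rw [hsum, Fintype.sum_prod_type,
    Finset.sum_eq_single_of_mem h (Finset.mem_univ _) (fun h' _ hne => by simp [hne])]
  simp only [if_true, Prod.mk.injEq, hXZ.joint_law]
  rw [← Finset.mul_sum, sum_prod_eq_prod_sum (fun _ => unigram (stoppedFamily h) (N + 1)),
    sum_unigram hr _ (by omega)]
  simp

/-- Each single walk is a Markov chain: the other walks and the negative samples integrate out. -/
theorem isWalkFrom [Nonempty V] (hr : 1 ≤ r) (hrow : ∀ i, ∑ j, W i j = 1)
    (hXZ : IsVECSampling P W w k X Z) (v : V) (p : Fin r) :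
    IsWalkFrom P W v fun ω => X ω v p where
  measurable := hXZ.measurable_walk v p
  law ℓ hℓ path := by
    obtain ⟨N, rfl⟩ : ∃ N, ℓ = N + 1 := ⟨ℓ - 1, by omega⟩
    set b : Fin (N + 1) → V := fun s => path s with hb
    have hset : {ω | ∀ s < N + 1, X ω v p s = path s} =
        {ω | walkHistory N (X ω) v p = b} := by
      ext ω
      simp only [Set.mem_ofPred_eq, hb, funext_iff, walkHistory]
      exact ⟨fun h s => h s s.2, fun h s hs => h ⟨s, hs⟩⟩
    have hsum := measureReal_preimage_eq_sum (P := P) (hXZ.measurable_walkHistory N)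
      (fun h => h v p = b)
    rw [hset, hsum]
    simp only [hXZ.walkHistory_law hr]
    -- the constraint on the walk `(v, p)` becomes one factor of the product over all walks
    have hprod : ∀ h : V → Fin r → Fin (N + 1) → V,
        (if h v p = b then ∏ v', ∏ p', walkProb W v' (N + 1) (stoppedPath (h v' p')) else 0) =
        ∏ v', ∏ p', (if v' = v ∧ p' = p then if h v' p' = b then 1 else 0 else 1) *
          walkProb W v' (N + 1) (stoppedPath (h v' p')) := by
      intro h
      simp only [Finset.prod_mul_distrib]
      have : ∏ v', ∏ p', (if v' = v ∧ p' = p then if h v' p' = b then (1 : ℝ) else 0 else 1) =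
          if h v p = b then 1 else 0 := by
        rw [Fintype.prod_eq_single v, Fintype.prod_eq_single p]
        · simp
        · intro p' hp'; simp [hp']
        · intro v' hv'; simp [hv']
      rw [this, ite_mul, one_mul, zero_mul]
    rw [Finset.sum_congr rfl fun h _ => hprod h,
      sum_prod_prod_eq_prod_prod_sum fun v' p' a =>
        (if v' = v ∧ p' = p then if a = b then (1 : ℝ) else 0 else 1) *
          walkProb W v' (N + 1) (stoppedPath a),
      Fintype.prod_eq_single v, Fintype.prod_eq_single p]
    · simp only [if_true, and_self, ite_mul, one_mul, zero_mul, Finset.sum_ite_eq',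
        Finset.mem_univ]
      exact walkProb_congr W v (by omega) fun s hs => stoppedPath_history path hs
    · intro p' hp'
      simp [hp', sum_walkProb_stoppedPath hrow]
    · intro v' hv'
      simp [hv', sum_walkProb_stoppedPath hrow]

/-- Given the walks, the deviation is a sum of independent centred indicators. -/
theorem integral_exp_negDeviation_le [Nonempty V] (hr : 1 ≤ r)
    (hXZ : IsVECSampling P W w k X Z) (i j : V) {ℓ : ℕ} (hℓ : 1 ≤ ℓ) {θ : ℝ} (hθ : |θ| ≤ 1) :
    ∫ ω, Real.exp (θ * negDeviation (X ω) (Z ℓ ω) i j) ∂P ≤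
      Real.exp (θ ^ 2 * (Fintype.card V * r * k * w * ℓ)) := by
  obtain ⟨N, rfl⟩ : ∃ N, ℓ = N + 1 := ⟨ℓ - 1, by omega⟩
  have hcond : ∀ (h : V → Fin r → Fin (N + 1) → V) (z : NegPosition V r w k (N + 1) → V),
      P.real {ω | walkHistory N (X ω) = h ∧ Z (N + 1) ω = z} =
        P.real {ω | walkHistory N (X ω) = h} * ∏ q, unigram (stoppedFamily h) (N + 1) (z q) := by
    intro h z
    rw [hXZ.joint_law, hXZ.walkHistory_law hr]
  have hK : ∀ h : V → Fin r → Fin (N + 1) → V,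
      ∑ z : NegPosition V r w k (N + 1) → V, (∏ q, unigram (stoppedFamily h) (N + 1) (z q)) *
        Real.exp (θ * negDeviation (stoppedFamily h) z i j) ≤
      Real.exp (θ ^ 2 * (Fintype.card V * r * k * w * (N + 1 : ℕ))) := by
    intro h
    have hz : ∀ z : NegPosition V r w k (N + 1) → V,
        (∏ q, unigram (stoppedFamily h) (N + 1) (z q)) *
          Real.exp (θ * negDeviation (stoppedFamily h) z i j) =
        ∏ q, (unigram (stoppedFamily h) (N + 1) (z q) * Real.exp (θ *
          ((if stoppedFamily h q.1.1 q.1.2.1 q.1.2.2.1.1 = i then 1 else 0) *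
            ((if z q = j then 1 else 0) - unigram (stoppedFamily h) (N + 1) j)))) := by
      intro z
      rw [negDeviation, Finset.mul_sum, Real.exp_sum, ← Finset.prod_mul_distrib]
    rw [Finset.sum_congr rfl fun z _ => hz z,
      sum_prod_eq_prod_sum fun (q : NegPosition V r w k (N + 1)) a =>
        unigram (stoppedFamily h) (N + 1) a * Real.exp (θ *
          ((if stoppedFamily h q.1.1 q.1.2.1 q.1.2.2.1.1 = i then 1 else 0) *
            ((if a = j then 1 else 0) - unigram (stoppedFamily h) (N + 1) j)))]
    calc _ ≤ ∏ _q : NegPosition V r w k (N + 1), Real.exp (θ ^ 2) := by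
          refine Finset.prod_le_prod (fun q _ => Finset.sum_nonneg fun a _ =>
            mul_nonneg (unigram_nonneg _ _ _) (Real.exp_pos _).le) fun q _ => ?_
          exact sum_mul_exp_centered_le (unigram_nonneg _ _) (sum_unigram hr _ (by omega)) j hθ
            (by split_ifs <;> simp)
      _ = Real.exp (θ ^ 2 * Fintype.card (NegPosition V r w k (N + 1))) := by
          rw [Finset.prod_const, Finset.card_univ, ← Real.exp_nat_mul, mul_comm]
      _ ≤ _ := by
          rw [Real.exp_le_exp]
          refine mul_le_mul_of_nonneg_left ?_ (sq_nonneg θ)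
          have h1 := card_skipPosition_le (N + 1) w
          have h2 : Fintype.card (NegPosition V r w k (N + 1)) ≤
              Fintype.card V * r * k * w * (N + 1) := by
            simp only [NegPosition, Fintype.card_prod, Fintype.card_fin]
            calc _ ≤ Fintype.card V * (r * ((N + 1) * w)) * k := by gcongr
              _ = _ := by ring
          exact_mod_cast h2
  have hstep := integral_mul_le_of_conditional (P := P) (hXZ.measurable_walkHistory N)
    (hXZ.measurable_sample (N + 1)) _ hcond (f := fun _ => 1) (fun _ => zero_le_one) hK
  have hcongr : ∀ ω, negDeviation (stoppedFamily (walkHistory N (X ω))) (Z (N + 1) ω) i j =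
      negDeviation (X ω) (Z (N + 1) ω) i j := fun ω =>
    (negDeviation_congr ((walkHistory_eq_iff (X ω) _).1 rfl) _ i j).symm
  simpa [hcongr] using hstep

omit [IsProbabilityMeasure P] in
theorem integrable_exp_negDeviation [IsFiniteMeasure P] (hXZ : IsVECSampling P W w k X Z)
    (i j : V) (ℓ : ℕ) (θ : ℝ) :
    Integrable (fun ω => Real.exp (θ * negDeviation (X ω) (Z ℓ ω) i j)) P := by
  have hYm : ∀ y : (V → Fin r → Fin (ℓ + 1) → V) × (NegPosition V r w k ℓ → V),
      MeasurableSet {ω | (walkHistory ℓ (X ω), Z ℓ ω) = y} := by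
    rintro ⟨h, z⟩
    simpa only [Prod.mk.injEq, Set.ofPred_and] using
      (hXZ.measurable_walkHistory ℓ h).inter (hXZ.measurable_sample ℓ z)
  have := integrable_comp_of_finite (P := P) hYm
    fun y => Real.exp (θ * negDeviation (stoppedFamily y.1) y.2 i j)
  refine this.congr (Eventually.of_forall fun ω => ?_)
  beta_reduce
  rw [negDeviation_congr (x := X ω) (x' := stoppedFamily (walkHistory ℓ (X ω)))]
  exact fun v p s hs => (walkHistory_eq_iff (X ω) _).1 rfl v p s (by omega)

theorem ae_tendsto_negDeviation [Nonempty V] (hr : 1 ≤ r) (hw : 1 ≤ w) (hk : 1 ≤ k)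
    (hXZ : IsVECSampling P W w k X Z) (i j : V) :
    ∀ᵐ ω ∂P, Tendsto (fun ℓ => negDeviation (X ω) (Z ℓ ω) i j / ℓ) atTop (𝓝 0) := by
  have hV : (0 : ℝ) < Fintype.card V := by exact_mod_cast Fintype.card_pos
  have hr' : (0 : ℝ) < r := by exact_mod_cast hr
  have hw' : (0 : ℝ) < w := by exact_mod_cast hw
  have hk' : (0 : ℝ) < k := by exact_mod_cast hk
  exact ae_tendsto_div_zero_of_exp_moment (S := fun ℓ ω => negDeviation (X ω) (Z ℓ ω) i j)
    (C := Fintype.card V * r * k * w) (by positivity)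
    (fun ℓ θ => hXZ.integrable_exp_negDeviation i j ℓ θ)
    fun ℓ hℓ θ hθ => hXZ.integral_exp_negDeviation_le hr i j hℓ hθ

end IsVECSampling

end Sampling

/-! ### Counts of visits and of skip-bigrams -/

section Counting

variable {V : Type*} [DecidableEq V]

/-- The number of visits of `x` to `j` before time `N`. -/
def visitCount (x : ℕ → V) (N : ℕ) (j : V) : ℝ :=
  ∑ s ∈ Finset.range N, if x s = j then 1 else 0

/-- The number of times `s < N` with `x (s - t) = i` and `x s = j`. -/
def lagCount (x : ℕ → V) (t N : ℕ) (i j : V) : ℝ :=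
  ∑ s ∈ Finset.range N, if t ≤ s ∧ x (s - t) = i ∧ x s = j then 1 else 0

theorem lagCount_zero (x : ℕ → V) (N : ℕ) (i j : V) :
    lagCount x 0 N i j = if i = j then visitCount x N i else 0 := by
  split_ifs with hij
  · subst hij
    simp [lagCount, visitCount]
  · refine Finset.sum_eq_zero fun s _ => if_neg ?_
    rintro ⟨-, h1, h2⟩
    exact hij (h1.symm.trans h2)

theorem lagCount_succ (x : ℕ → V) (t N : ℕ) (i j : V) :
    lagCount x t (N + 1) i j =
      lagCount x t N i j + if t ≤ N ∧ x (N - t) = i ∧ x N = j then 1 else 0 :=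
  Finset.sum_range_succ _ _

variable [Fintype V]

theorem innovationSum_eq (W : Matrix V V ℝ) (x : ℕ → V) (t N : ℕ) (i j : V) :
    innovationSum W x t i j N =
      lagCount x (t + 1) (N + 1) i j - ∑ k, lagCount x t N i k * W k j := by
  have h1 : lagCount x (t + 1) (N + 1) i j =
      ∑ s ∈ Finset.range N, (if t ≤ s ∧ x (s - t) = i then 1 else 0) *
        (if x (s + 1) = j then 1 else 0) := by
    rw [lagCount, Finset.sum_range_succ', if_neg (by simp), add_zero]
    refine Finset.sum_congr rfl fun s _ => ?_
    rw [Nat.add_sub_add_right, ite_mul, one_mul, zero_mul, ← ite_and]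
    simp only [Nat.add_le_add_iff_right, and_assoc]
  have h2 : ∑ k, lagCount x t N i k * W k j =
      ∑ s ∈ Finset.range N, (if t ≤ s ∧ x (s - t) = i then 1 else 0) * W (x s) j := by
    simp only [lagCount, Finset.sum_mul]
    rw [Finset.sum_comm]
    refine Finset.sum_congr rfl fun s _ => ?_
    by_cases h : t ≤ s ∧ x (s - t) = i
    · simp [h]
    · rw [if_neg h, zero_mul]
      refine Finset.sum_eq_zero fun k _ => ?_
      rw [if_neg (fun h' => h ⟨h'.1, h'.2.1⟩), zero_mul]
  rw [h1, h2, ← Finset.sum_sub_distrib]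
  exact Finset.sum_congr rfl fun s _ => mul_sub _ _ _

theorem tendsto_bounded_div_natCast {c : ℕ → ℝ} {C : ℝ} (hc : ∀ N, |c N| ≤ C) :
    Tendsto (fun N : ℕ => c N / N) atTop (𝓝 0) := by
  refine squeeze_zero_norm (a := fun N : ℕ => C / N) (fun N => ?_)
    (tendsto_const_div_atTop_nhds_zero_nat C)
  rw [norm_div, Real.norm_eq_abs, Real.norm_natCast]
  gcongr
  exact hc N

/-- If the innovations average out, transitions of lag `t` have asymptotic frequencies `W ^ t`. -/
theorem tendsto_lagCount_sub {W : Matrix V V ℝ} {x : ℕ → V}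
    (hx : ∀ t i j, Tendsto (fun N => innovationSum W x t i j N / N) atTop (𝓝 0)) (t : ℕ) (i j : V) :
    Tendsto (fun N : ℕ => lagCount x t N i j / N - visitCount x N i / N * (W ^ t) i j)
      atTop (𝓝 0) := by
  induction t generalizing j with
  | zero =>
    refine tendsto_const_nhds.congr fun N => ?_
    rw [lagCount_zero, pow_zero, Matrix.one_apply]
    split_ifs <;> simp
  | succ t ih =>
    have hb : Tendsto (fun N : ℕ =>
        (if t + 1 ≤ N ∧ x (N - (t + 1)) = i ∧ x N = j then (1 : ℝ) else 0) / N) atTop (𝓝 0) :=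
      tendsto_bounded_div_natCast (C := 1) fun N => by split_ifs <;> simp
    have hs : Tendsto (fun N : ℕ =>
        ∑ k, (lagCount x t N i k / N - visitCount x N i / N * (W ^ t) i k) * W k j)
        atTop (𝓝 (∑ k, 0 * W k j)) :=
      tendsto_finsetSum _ fun k _ => (ih k).mul_const _
    have := ((hx t i j).sub hb).add hs
    simp only [zero_mul, Finset.sum_const_zero, sub_zero, add_zero] at this
    refine this.congr fun N => ?_
    rw [innovationSum_eq, lagCount_succ, pow_succ, Matrix.mul_apply]
    simp only [sub_mul, Finset.sum_sub_distrib, Finset.mul_sum, sub_div, add_div, Finset.sum_div,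
      mul_assoc, div_mul_eq_mul_div]
    ring

/-- If the innovations average out, the empirical distribution is asymptotically stationary. -/
theorem tendsto_visitCount_sub {W : Matrix V V ℝ} {x : ℕ → V}
    (hx : ∀ t i j, Tendsto (fun N => innovationSum W x t i j N / N) atTop (𝓝 0)) (j : V) :
    Tendsto (fun N : ℕ => visitCount x N j / N - ∑ i, visitCount x N i / N * W i j)
      atTop (𝓝 0) := by
  have hs : Tendsto (fun N : ℕ => ∑ i, (lagCount x 1 N i j / N - visitCount x N i / N *
      (W ^ 1) i j)) atTop (𝓝 (∑ _i : V, 0)) :=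
    tendsto_finsetSum _ fun i _ => tendsto_lagCount_sub hx 1 i j
  have hb : Tendsto (fun N : ℕ =>
      (visitCount x N j - ∑ i, lagCount x 1 N i j) / N) atTop (𝓝 0) := by
    refine tendsto_bounded_div_natCast (C := 1) fun N => ?_
    have hlag : ∑ i, lagCount x 1 N i j =
        ∑ s ∈ Finset.range N, if 1 ≤ s ∧ x s = j then 1 else 0 := by
      simp only [lagCount]
      rw [Finset.sum_comm]
      refine Finset.sum_congr rfl fun s _ => ?_
      by_cases h : 1 ≤ s ∧ x s = j
      · simp [h]
      · rw [if_neg h]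
        exact Finset.sum_eq_zero fun i _ => if_neg fun h' => h ⟨h'.1, h'.2.2⟩
    rw [hlag, visitCount, ← Finset.sum_sub_distrib]
    rcases N with _ | N
    · simp
    · rw [Finset.sum_range_succ', Finset.sum_eq_zero (fun s _ => by simp), zero_add]
      rw [if_neg (by simp : ¬ (1 ≤ 0 ∧ x 0 = j)), sub_zero]
      split_ifs <;> simp
  have := hs.add hb
  simp only [Finset.sum_const_zero, add_zero, pow_one] at this
  refine this.congr fun N => ?_
  rw [Finset.sum_sub_distrib, sub_div, Finset.sum_div]
  ring

/-- A positive pair is a pair of times `(s' - t, s')` with lag `1 ≤ t ≤ w`. -/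
theorem posCount_eq {r : ℕ} (x : WalkFamily V r) (w ℓ : ℕ) (i j : V) :
    (posCount x w ℓ i j : ℝ) =
      ∑ v, ∑ p, ∑ t ∈ Finset.Icc 1 w, lagCount (x v p) t ℓ i j := by
  have hpos : (posCount x w ℓ i j : ℝ) = ∑ v, ∑ p, ∑ e : SkipPosition ℓ w,
      if x v p e.1.1 = i ∧ x v p e.1.2 = j then (1 : ℝ) else 0 := by
    rw [posCount, Fintype.card_subtype, Finset.card_filter]
    push_cast
    simp only [Fintype.sum_prod_type (α₁ := V), Fintype.sum_prod_type (α₁ := Fin r)]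
  rw [hpos]
  refine Finset.sum_congr rfl fun v _ => Finset.sum_congr rfl fun p _ => ?_
  simp only [lagCount]
  rw [← Finset.sum_product', Finset.sum_boole, Finset.sum_boole]
  congr 1
  refine Finset.card_bij (fun e _ => ((e.1.2 : ℕ) - e.1.1, (e.1.2 : ℕ))) ?_ ?_ ?_
  · rintro ⟨⟨a, b⟩, h1, h2⟩ he
    have h1' : (a : ℕ) < b := h1
    simp only [Finset.mem_filter, Finset.mem_univ, true_and] at he
    simp only [Finset.mem_filter, Finset.mem_product, Finset.mem_Icc, Finset.mem_range]
    rw [show (b : ℕ) - (b - a) = a by omega]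
    exact ⟨⟨⟨by omega, by simp only at h2; omega⟩, b.2⟩, by omega, he⟩
  · rintro ⟨⟨a, b⟩, h1, h2⟩ _ ⟨⟨c, d⟩, h3, h4⟩ _ h
    have h1' : (a : ℕ) < b := h1
    have h3' : (c : ℕ) < d := h3
    simp only [Prod.mk.injEq] at h
    simp only [Subtype.mk.injEq, Prod.mk.injEq, Fin.ext_iff]
    omega
  · rintro ⟨t, s⟩ h
    simp only [Finset.mem_filter, Finset.mem_product, Finset.mem_Icc, Finset.mem_range] at h
    obtain ⟨⟨⟨ht1, htw⟩, hs⟩, hts, hij⟩ := h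
    refine ⟨⟨(⟨s - t, by omega⟩, ⟨s, hs⟩), ?_, ?_⟩, ?_, ?_⟩
    · exact Fin.mk_lt_mk.2 (by omega)
    · show s ≤ s - t + w
      omega
    · simpa using hij
    · simp only [Prod.mk.injEq, and_true]
      omega

/-- The number of visits of all the walks to `j` before time `N`. -/
def totalVisits {r : ℕ} (x : WalkFamily V r) (N : ℕ) (j : V) : ℝ :=
  ∑ v, ∑ p, visitCount (x v p) N j

theorem unigram_eq {r : ℕ} (x : WalkFamily V r) (ℓ : ℕ) (j : V) :
    unigram x ℓ j = totalVisits x ℓ j / ℓ / (Fintype.card V * r) := by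
  rw [unigram, Fintype.card_subtype, Finset.card_filter, div_div, mul_comm (ℓ : ℝ)]
  congr 1
  push_cast
  simp only [Fintype.sum_prod_type, totalVisits, visitCount, Finset.sum_range]

section Limits

variable {r : ℕ} {x : WalkFamily V r} {W : Matrix V V ℝ}

theorem tendsto_totalVisits_sub
    (hx : ∀ v p t i j, Tendsto (fun N => innovationSum W (x v p) t i j N / N) atTop (𝓝 0)) (j : V) :
    Tendsto (fun N : ℕ => totalVisits x N j / N - ∑ i, totalVisits x N i / N * W i j)
      atTop (𝓝 0) := by
  have h : Tendsto (fun N : ℕ => ∑ v, ∑ p, (visitCount (x v p) N j / N -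
      ∑ i, visitCount (x v p) N i / N * W i j)) atTop (𝓝 (∑ _v : V, ∑ _p : Fin r, 0)) :=
    tendsto_finsetSum _ fun v _ => tendsto_finsetSum _ fun p _ =>
      tendsto_visitCount_sub (hx v p) j
  simp only [Finset.sum_const_zero] at h
  refine h.congr fun N => ?_
  have hswap : ∑ v, ∑ p, ∑ i, visitCount (x v p) N i / N * W i j =
      ∑ i, totalVisits x N i / N * W i j := by
    simp only [totalVisits, Finset.sum_div, Finset.sum_mul]
    exact (Finset.sum_comm.trans (Finset.sum_congr rfl fun v _ => Finset.sum_comm)).symm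
  simp only [Finset.sum_sub_distrib]
  rw [hswap, totalVisits, Finset.sum_div]
  simp only [Finset.sum_div]

theorem tendsto_posCount
    (hx : ∀ v p t i j, Tendsto (fun N => innovationSum W (x v p) t i j N / N) atTop (𝓝 0))
    {i : V} {c : ℝ} (hc : Tendsto (fun N : ℕ => totalVisits x N i / N) atTop (𝓝 c))
    (w : ℕ) (j : V) :
    Tendsto (fun ℓ : ℕ => (posCount x w ℓ i j : ℝ) / ℓ) atTop
      (𝓝 (c * ∑ t ∈ Finset.Icc 1 w, (W ^ t) i j)) := by
  have h : Tendsto (fun N : ℕ => ∑ v, ∑ p, ∑ t ∈ Finset.Icc 1 w, (lagCount (x v p) t N i j / N -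
      visitCount (x v p) N i / N * (W ^ t) i j)) atTop
      (𝓝 (∑ _v : V, ∑ _p : Fin r, ∑ _t ∈ Finset.Icc 1 w, 0)) :=
    tendsto_finsetSum _ fun v _ => tendsto_finsetSum _ fun p _ => tendsto_finsetSum _ fun t _ =>
      tendsto_lagCount_sub (hx v p) t i j
  have h2 := h.add (hc.mul_const (∑ t ∈ Finset.Icc 1 w, (W ^ t) i j))
  simp only [Finset.sum_const_zero, zero_add] at h2
  refine h2.congr fun N => ?_
  rw [posCount_eq]
  simp only [Finset.sum_sub_distrib, ← Finset.mul_sum, ← Finset.sum_mul, ← Finset.sum_div,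
    totalVisits]
  ring

theorem tendsto_negCount [Nonempty V] (hr : 1 ≤ r)
    (hx : ∀ v p t i j, Tendsto (fun N => innovationSum W (x v p) t i j N / N) atTop (𝓝 0))
    (hrow : ∀ i, ∑ j, W i j = 1)
    (hc : ∀ i, Tendsto (fun N : ℕ => totalVisits x N i / N) atTop (𝓝 r)) {w k : ℕ}
    {z : (ℓ : ℕ) → NegPosition V r w k ℓ → V} (i j : V)
    (hz : Tendsto (fun ℓ => negDeviation x (z ℓ) i j / ℓ) atTop (𝓝 0)) :
    Tendsto (fun ℓ : ℕ => (negCount x (z ℓ) i j : ℝ) / ℓ) atTop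
      (𝓝 (k * (r * w) * (1 / Fintype.card V))) := by
  have hr' : (r : ℝ) ≠ 0 := by positivity
  have hpow : ∀ (t : ℕ) i, ∑ j, (W ^ t) i j = 1 := by
    intro t
    induction t with
    | zero => intro i; simp [Matrix.one_apply]
    | succ t ih =>
      intro i
      simp only [pow_succ, Matrix.mul_apply]
      rw [Finset.sum_comm]
      simp only [← Finset.mul_sum, hrow, mul_one, ih]
  have hpos : Tendsto (fun ℓ : ℕ => ((∑ j', posCount x w ℓ i j' : ℕ) : ℝ) / ℓ) atTop
      (𝓝 (r * w)) := by
    have h : Tendsto (fun ℓ : ℕ => ∑ j', (posCount x w ℓ i j' : ℝ) / ℓ) atTop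
        (𝓝 (∑ j', r * ∑ t ∈ Finset.Icc 1 w, (W ^ t) i j')) :=
      tendsto_finsetSum _ fun j' _ => tendsto_posCount hx (hc i) w j'
    rw [← Finset.mul_sum, Finset.sum_comm] at h
    simp only [hpow, Finset.sum_const, Nat.card_Icc, Nat.add_sub_cancel, nsmul_eq_mul,
      mul_one] at h
    refine h.congr fun ℓ => ?_
    rw [← Finset.sum_div]
    push_cast
    rfl
  have huni : Tendsto (fun ℓ : ℕ => unigram x ℓ j) atTop (𝓝 (1 / Fintype.card V)) := by
    have h := (hc j).div_const (Fintype.card V * r : ℝ)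
    have e : (r : ℝ) / (Fintype.card V * r) = 1 / Fintype.card V := by
      field_simp
    rw [e] at h
    simpa only [unigram_eq] using h
  have h := hz.add ((hpos.const_mul (k : ℝ)).mul huni)
  rw [zero_add] at h
  refine h.congr fun ℓ => ?_
  rw [negDeviation_eq]
  ring

end Limits

end Counting

/-! ### Equidistribution of the walks -/

theorem sum_visitCount_sameBlock {n : ℕ} {y : Fin n → Fin 2} {x : ℕ → Fin n} (i : Fin n) (N : ℕ) :
    ∑ j, (if y i = y j then visitCount x N j else 0) =
      ∑ s ∈ Finset.range N, if y i = y (x s) then (1 : ℝ) else 0 := by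
  have h : ∀ j, (if y i = y j then visitCount x N j else 0) =
      ∑ s ∈ Finset.range N, if y i = y j then (if x s = j then (1 : ℝ) else 0) else 0 := by
    intro j
    split_ifs
    · rfl
    · simp
  rw [Finset.sum_congr rfl fun j _ => h j, Finset.sum_comm]
  refine Finset.sum_congr rfl fun s _ => ?_
  rw [Finset.sum_eq_single_of_mem (x s) (Finset.mem_univ _) fun j _ hj => by simp [hj.symm]]
  simp

/-- The `n r` walks together visit all nodes equally often. Asymptotic stationarity reduces this to
the time spent in each community, which is half of the total: if `b = 0` because the walks stay in
the community they start in, and otherwise again by stationarity. -/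
theorem tendsto_totalVisits {n m : ℕ} (hm : 1 ≤ m) (hn : n = 2 * m) {y : Fin n → Fin 2}
    (hy : ∀ c : Fin 2, (Finset.univ.filter fun i => y i = c).card = m) {a b D : ℝ}
    (ha : 0 < a) (hb : 0 ≤ b) (hD : D = (m - 1) * a + m * b) (hD0 : 0 < D)
    {W : Matrix (Fin n) (Fin n) ℝ}
    (hW : ∀ i j, W i j = ((if y i = y j then a else b) - if i = j then a else 0) / D)
    {r : ℕ} {x : WalkFamily (Fin n) r}
    (hx : ∀ v p t i j, Tendsto (fun N => innovationSum W (x v p) t i j N / N) atTop (𝓝 0))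
    (hstay : b = 0 → ∀ v p s, y (x v p s) = y v) (j : Fin n) :
    Tendsto (fun N : ℕ => totalVisits x N j / N) atTop (𝓝 r) := by
  have hm' : (0 : ℝ) < m := by exact_mod_cast hm
  have hn' : (n : ℝ) = 2 * m := by exact_mod_cast hn
  set M : Fin n → ℕ → ℝ := fun i N => ∑ j, if y i = y j then totalVisits x N j / N else 0 with hM
  have hM' : ∀ i N, M i N = (∑ v, ∑ p, ∑ s ∈ Finset.range N,
      if y i = y (x v p s) then (1 : ℝ) else 0) / N := by
    intro i N
    have h1 : M i N = (∑ j, ∑ v, ∑ p, if y i = y j then visitCount (x v p) N j else 0) / N := by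
      rw [Finset.sum_div]
      refine Finset.sum_congr rfl fun j _ => ?_
      split_ifs
      · rfl
      · simp
    rw [h1]
    congr 1
    rw [Finset.sum_comm]
    refine Finset.sum_congr rfl fun v _ => ?_
    rw [Finset.sum_comm]
    exact Finset.sum_congr rfl fun p _ => sum_visitCount_sameBlock i N
  have htot : ∀ N : ℕ, 1 ≤ N → ∑ j, totalVisits x N j / N = n * r := by
    intro N hN
    have hN' : (N : ℝ) ≠ 0 := by positivity
    rw [← Finset.sum_div, div_eq_iff hN']
    simp only [totalVisits]
    rw [Finset.sum_comm]
    have : ∀ v, ∑ j, ∑ p, visitCount (x v p) N j = r * N := by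
      intro v
      rw [Finset.sum_comm]
      have : ∀ p, ∑ j, visitCount (x v p) N j = N := by
        intro p
        simp only [visitCount]
        rw [Finset.sum_comm]
        simp
      simp [this]
    simp [this, mul_assoc]
  -- stationarity, with the sum over predecessors evaluated block by block
  have hstat : ∀ j, Tendsto (fun N : ℕ => (D + a) * (totalVisits x N j / N) -
      (a - b) * M j N - b * (n * r)) atTop (𝓝 0) := by
    intro j
    have h := (tendsto_totalVisits_sub hx j).const_mul D
    rw [mul_zero] at h
    refine h.congr' ?_
    filter_upwards [eventually_ge_atTop 1] with N hN
    have hsum : D * ∑ i, totalVisits x N i / N * W i j =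
        (a - b) * M j N + b * (n * r) - a * (totalVisits x N j / N) := by
      rw [← htot N hN, hM, Finset.mul_sum, Finset.mul_sum, Finset.mul_sum, ← Finset.sum_add_distrib]
      have hj : a * (totalVisits x N j / N) =
          ∑ i, if i = j then a * (totalVisits x N i / N) else 0 := by
        simp
      rw [hj, ← Finset.sum_sub_distrib]
      refine Finset.sum_congr rfl fun i _ => ?_
      rw [hW]
      simp only [eq_comm (a := y j)]
      split_ifs <;> field_simp <;> ring
    rw [mul_sub, hsum]
    ring
  have hMlim : ∀ i, Tendsto (M i) atTop (𝓝 (m * r)) := by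
    intro i
    rcases hb.eq_or_lt with hb0 | hb0
    · refine tendsto_const_nhds.congr' ?_
      filter_upwards [eventually_ge_atTop 1] with N hN
      have hN' : (N : ℝ) ≠ 0 := by positivity
      have h1 := sum_ite_sameBlock hn hy i 1 0
      simp only [hM', hstay hb0.symm, Finset.sum_const, Finset.card_range, Finset.card_univ,
        Fintype.card_fin, nsmul_eq_mul, ← Finset.mul_sum, h1]
      field_simp
      ring
    · have h : Tendsto (fun N : ℕ => ∑ j, if y i = y j then ((D + a) * (totalVisits x N j / N) -
          (a - b) * M j N - b * (n * r)) else 0) atTop (𝓝 (∑ j, if y i = y j then 0 else 0)) :=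
        tendsto_finsetSum _ fun j _ => by
          by_cases hij : y i = y j
          · simpa [hij] using hstat j
          · simp [hij]
      have h2 := (h.div_const (2 * m * b)).add_const (m * r : ℝ)
      simp only [ite_self, Finset.sum_const_zero, zero_div, zero_add] at h2
      refine h2.congr fun N => ?_
      have hMeq : ∀ j, y i = y j → M j N = M i N := fun j hij => by simp only [hM, hij]
      have hrow : ∀ j, (if y i = y j then ((D + a) * (totalVisits x N j / N) -
          (a - b) * M j N - b * (n * r)) else 0) =
          (D + a) * (if y i = y j then totalVisits x N j / N else 0) -
            if y i = y j then (a - b) * M i N + b * (n * r) else 0 := by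
        intro j
        split_ifs with hij
        · rw [hMeq j hij]; ring
        · ring
      rw [Finset.sum_congr rfl fun j _ => hrow j, Finset.sum_sub_distrib, ← Finset.mul_sum,
        sum_ite_sameBlock hn hy, hD, hn']
      have : (∑ j, if y i = y j then totalVisits x N j / N else 0) = M i N := rfl
      rw [this]
      field_simp
      ring
  have h := (((hstat j).add ((hMlim j).const_mul (a - b))).add_const (b * (n * r))).div_const
    (D + a)
  have hlim : (0 + (a - b) * (m * r) + b * (n * r)) / (D + a) = r := by
    rw [div_eq_iff (by positivity), hD, hn']
    ring
  rw [hlim] at h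
  refine h.congr fun N => ?_
  have : D + a ≠ 0 := by positivity
  field_simp
  ring

/-! ### Ergodic limits and minimizers -/

theorem sum_Icc_neg_pow_nonpos {θ : ℝ} (h0 : 0 ≤ θ) (h1 : θ ≤ 1) (w : ℕ) :
    ∑ t ∈ Finset.Icc 1 w, (-θ) ^ t ≤ 0 := by
  have hgeom : (1 + θ) * ∑ t ∈ Finset.Icc 1 w, (-θ) ^ t = -θ * (1 - (-θ) ^ w) := by
    induction w with
    | zero => simp
    | succ w ih =>
      rw [Finset.sum_Icc_succ_top (by omega), mul_add, ih, pow_succ]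
      ring
  have hpow : (-θ) ^ w ≤ 1 := by
    refine (le_abs_self _).trans ?_
    rw [abs_pow, abs_neg, abs_of_nonneg h0]
    exact pow_le_one₀ h0 h1
  have : (1 + θ) * ∑ t ∈ Finset.Icc 1 w, (-θ) ^ t ≤ 0 := by
    rw [hgeom]
    nlinarith
  exact nonpos_of_mul_nonpos_right this (by linarith)

/-- On the expected graph the ergodic limits of the counts are the averages of the powers of the
transition matrix over the window, and the uniform matrix. -/
theorem isErgodicLimit_sbm {n m : ℕ} (hm : 1 ≤ m) (hn : n = 2 * m) {y : Fin n → Fin 2}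
    (hy : ∀ c : Fin 2, (Finset.univ.filter fun i => y i = c).card = m) {a b D : ℝ}
    (ha : 0 < a) (hb : 0 ≤ b) (hD : D = (m - 1) * a + m * b) (hD0 : 0 < D)
    {W : Matrix (Fin n) (Fin n) ℝ}
    (hW : ∀ i j, W i j = ((if y i = y j then a else b) - if i = j then a else 0) / D)
    (hWnn : ∀ i j, 0 ≤ W i j) (hrow : ∀ i, ∑ j, W i j = 1)
    {r w k : ℕ} (hr : 1 ≤ r) (hw : 1 ≤ w) (hk : 1 ≤ k)
    {Ω : Type*} [MeasurableSpace Ω] {P : Measure Ω} [IsProbabilityMeasure P]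
    {X : Ω → WalkFamily (Fin n) r} {Z : (ℓ : ℕ) → Ω → NegPosition (Fin n) r w k ℓ → Fin n}
    (hXZ : IsVECSampling P W w k X Z) :
    IsErgodicLimit P X Z (Matrix.of fun i j => 1 / (n : ℝ) * ∑ t ∈ Finset.Icc 1 w, (W ^ t) i j)
      (Matrix.of fun _ _ => (k : ℝ) * w / (n : ℝ) ^ 2) := by
  have hn0 : (0 : ℝ) < n := by
    have : 0 < n := by omega
    exact_mod_cast this
  have hr0 : (0 : ℝ) < r := by exact_mod_cast hr
  have : Nonempty (Fin n) := ⟨⟨0, by omega⟩⟩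
  have hwalk := hXZ.isWalkFrom hr hrow
  have hinn : ∀ᵐ ω ∂P, ∀ v p t i j,
      Tendsto (fun N => innovationSum W (X ω v p) t i j N / N) atTop (𝓝 0) := by
    simp only [ae_all_iff]
    exact fun v p t i j => (hwalk v p).ae_tendsto_innovationSum hWnn hrow t i j
  -- if `b = 0`, a step between the communities has probability zero
  have hstay : ∀ᵐ ω ∂P, b = 0 → ∀ v p s, y (X ω v p s) = y v := by
    have h : ∀ᵐ ω ∂P, ∀ v p, X ω v p 0 = v ∧ ∀ N, W (X ω v p N) (X ω v p (N + 1)) ≠ 0 := by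
      refine ae_all_iff.2 fun v => ae_all_iff.2 fun p => ?_
      exact (hwalk v p).ae_start.and (hwalk v p).ae_step_ne_zero
    filter_upwards [h] with ω hω hb' v p s
    induction s with
    | zero => rw [(hω v p).1]
    | succ s ih =>
      rw [← ih]
      by_contra hne
      have hne' : X ω v p s ≠ X ω v p (s + 1) := fun h => hne (by rw [h])
      refine (hω v p).2 s ?_
      rw [hW, if_neg (Ne.symm hne), if_neg hne', hb', sub_zero, zero_div]
  intro i j
  filter_upwards [hinn, hstay, hXZ.ae_tendsto_negDeviation hr hw hk i j] with ω hω hs hneg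
  have hvisits := tendsto_totalVisits hm hn hy ha hb hD hD0 hW hω hs
  constructor
  · have h := (tendsto_posCount hω (hvisits i) w j).const_mul (1 / ((r : ℝ) * Fintype.card (Fin n)))
    convert h using 2
    rw [Matrix.of_apply, Fintype.card_fin]
    field_simp
  · have h := (tendsto_negCount hr hω hrow hvisits i j hneg).const_mul
      (1 / ((r : ℝ) * Fintype.card (Fin n)))
    convert h using 2
    rw [Matrix.of_apply, Fintype.card_fin]
    field_simp

theorem corollary1 (n m : ℕ) (hm : 2 ≤ m) (hn : n = 2 * m)
    (y : Fin n → Fin 2) (hy : ∀ c : Fin 2, (Finset.univ.filter fun i => y i = c).card = m)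
    (a b : ℝ) (ha : a ∈ Set.Icc (0 : ℝ) 1) (hb : b ∈ Set.Icc (0 : ℝ) 1)
    (hab : (m : ℝ) / ((m : ℝ) - 1) * b < a)
    -- the random graph
    {Ω : Type*} [MeasurableSpace Ω] (μ : Measure Ω) [IsProbabilityMeasure μ]
    (G : Ω → SimpleGraph (Fin n)) (hG : IsSBM μ G y !![a, b; b, a])
    -- the random walks and negative samples on the expected graph
    (r w k : ℕ) (hr : 1 ≤ r) (hw : 1 ≤ w) (hk : 1 ≤ k)
    {Ω' : Type*} [MeasurableSpace Ω'] (P : Measure Ω') [IsProbabilityMeasure P]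
    (X : Ω' → WalkFamily (Fin n) r) (Z : (ℓ : ℕ) → Ω' → NegPosition (Fin n) r w k ℓ → Fin n)
    (hXZ : IsVECSampling P (naturalWalk (expectedAdj μ G)) w k X Z) :
    ∃ (Nplus Nminus : Matrix (Fin n) (Fin n) ℝ) (α₁ α₂ α₃ β : ℝ),
      -- the ergodic limits and their block values
      IsErgodicLimit P X Z Nplus Nminus ∧
      (∀ i j, Nplus i j = if i = j then α₃ else if y i = y j then α₁ else α₂) ∧
      (∀ i j, Nminus i j = β) ∧ β = (k : ℝ) * w / (n : ℝ) ^ 2 ∧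
      -- the minimizer under the positive semidefinite constraint alone, and its rank
      argminSet (gramObjective Nplus Nminus) (psdCone (Fin n)) =
        {communityGram y (nuOne m α₁ α₂ α₃ β)} ∧
      (communityGram y (nuOne m α₁ α₂ α₃ β)).rank = 1 ∧
      -- the same matrix is the unique minimizer under a rank constraint
      (∀ d : ℕ, 1 ≤ d → argminSet (gramObjective Nplus Nminus) (psdRankLE (Fin n) d) =
        {communityGram y (nuOne m α₁ α₂ α₃ β)}) ∧
      -- and under a nuclear norm constraint
      (∀ ν : ℝ, nuOne m α₁ α₂ α₃ β * n ≤ ν →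
        argminSet (gramObjective Nplus Nminus) (psdNuclearLE (Fin n) ν) =
          {communityGram y (nuOne m α₁ α₂ α₃ β)}) := by
  have hm0 : (0 : ℝ) < m := by positivity
  have hm2 : (2 : ℝ) ≤ m := by exact_mod_cast hm
  have hn' : (n : ℝ) = 2 * m := by exact_mod_cast hn
  have hn0 : (0 : ℝ) < n := by rw [hn']; positivity
  have hr0 : (0 : ℝ) < r := by exact_mod_cast hr
  have hw0 : (0 : ℝ) < w := by exact_mod_cast hw
  have hk1 : (1 : ℝ) ≤ k := by exact_mod_cast hk
  have hm1 : 1 ≤ m := by omega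
  have : Nonempty (Fin n) := ⟨⟨0, by omega⟩⟩
  have hb0 : 0 ≤ b := hb.1
  have hab' : m * b < (m - 1) * a := by
    have hpos : (0 : ℝ) < m - 1 := by linarith
    have := mul_lt_mul_of_pos_left hab hpos
    field_simp at this
    linarith
  have ha0 : 0 < a := lt_of_le_of_lt (by
    have : (0 : ℝ) < m - 1 := by linarith
    positivity) hab
  set D : ℝ := (m - 1) * a + m * b with hD
  have hD0 : 0 < D := by nlinarith
  set W := naturalWalk (expectedAdj μ G) with hWdef
  have hW : ∀ i j, W i j = ((if y i = y j then a else b) - if i = j then a else 0) / D :=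
    naturalWalk_apply_sbm hn hy hG
  have hWnn : ∀ i j, 0 ≤ W i j := by
    intro i j
    rw [hW]
    refine div_nonneg ?_ hD0.le
    by_cases hij : i = j
    · simp [hij]
    · rw [if_neg hij, sub_zero]; split_ifs <;> linarith
  have hrow : ∀ i, ∑ j, W i j = 1 := by
    intro i
    simp only [hW]
    rw [← Finset.sum_div, Finset.sum_sub_distrib, sum_ite_sameBlock hn hy, Finset.sum_ite_eq,
      if_pos (Finset.mem_univ _), div_eq_one_iff_eq hD0.ne', hD]
    ring
  set lam : ℝ := ((m - 1) * a - m * b) / D with hlam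
  set th : ℝ := a / D with hth
  have hlam0 : 0 < lam := div_pos (by linarith) hD0
  have hlam1 : lam ≤ 1 := by
    rw [hlam, div_le_one hD0, hD]
    nlinarith
  have hth0 : 0 ≤ th := (div_pos ha0 hD0).le
  have hth1 : th ≤ 1 := by
    rw [hth, div_le_one hD0, hD]
    nlinarith
  have hpow : ∀ t, W ^ t = blockKernel m y lam th t := fun t =>
    pow_eq_blockKernel hm1 hn hy hD hD0.ne' hW t
  set L : ℝ := ∑ t ∈ Finset.Icc 1 w, lam ^ t with hL
  set T : ℝ := ∑ t ∈ Finset.Icc 1 w, (-th) ^ t with hT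
  have hT0 : T ≤ 0 := sum_Icc_neg_pow_nonpos hth0 hth1 w
  have hL0 : 0 < L := Finset.sum_pos (fun t _ => pow_pos hlam0 t) ⟨1, by simp [hw]⟩
  have hLw : L ≤ w := by
    have : L ≤ ∑ t ∈ Finset.Icc 1 w, (1 : ℝ) :=
      Finset.sum_le_sum fun t _ => pow_le_one₀ hlam0.le hlam1
    simpa using this
  set Np : Matrix (Fin n) (Fin n) ℝ :=
    Matrix.of fun i j => 1 / n * ∑ t ∈ Finset.Icc 1 w, (W ^ t) i j with hNp
  have hNpeq : ∀ i j, Np i j = 1 / n * (w / n + L * (if y i = y j then 1 else -1) / n +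
      T * ((if i = j then 1 else 0) - (if y i = y j then 1 / (m : ℝ) else 0))) := by
    intro i j
    simp only [hNp, Matrix.of_apply, hpow, blockKernel, Finset.sum_add_distrib, ← Finset.sum_mul,
      ← Finset.sum_div, Finset.sum_const, Nat.card_Icc, Nat.add_sub_cancel, nsmul_eq_mul,
      mul_one, ← hL, ← hT]
  obtain ⟨α₁, hα₁⟩ : ∃ α₁ : ℝ, α₁ = 1 / n * (w / n + L / n - T / m) := ⟨_, rfl⟩
  obtain ⟨α₂, hα₂⟩ : ∃ α₂ : ℝ, α₂ = 1 / n * (w / n - L / n) := ⟨_, rfl⟩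
  obtain ⟨α₃, hα₃⟩ : ∃ α₃ : ℝ, α₃ = 1 / n * (w / n + L / n + T * (1 - 1 / m)) := ⟨_, rfl⟩
  obtain ⟨β, hβ⟩ : ∃ β : ℝ, β = k * w / n ^ 2 := ⟨_, rfl⟩
  have hblock : ∀ i j, Np i j = if i = j then α₃ else if y i = y j then α₁ else α₂ := by
    intro i j
    rw [hNpeq]
    by_cases hij : i = j
    · simp only [hij, if_true, hα₃]; ring
    · by_cases hyij : y i = y j
      · simp only [hij, hyij, if_true, if_false, hα₁]; ring
      · simp only [hij, hyij, if_false, hα₂]; ring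
  have hα₁0 : 0 ≤ α₁ := by
    have : T / m ≤ 0 := div_nonpos_of_nonpos_of_nonneg hT0 hm0.le
    have h2 : 0 ≤ w / (n : ℝ) + L / n := by positivity
    rw [hα₁]
    exact mul_nonneg (by positivity) (by linarith)
  have hα₂0 : 0 ≤ α₂ := by
    rw [hα₂, ← sub_div]
    exact mul_nonneg (by positivity) (div_nonneg (by linarith) hn0.le)
  have hα₃0 : 0 ≤ α₃ := by
    have i : Fin n := Classical.arbitrary _
    have h1 : Np i i = α₃ := by rw [hblock, if_pos rfl]
    -- a return frequency, hence nonnegative although `T` may be negative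
    rw [← h1, hNp]
    exact mul_nonneg (by positivity)
      (Finset.sum_nonneg fun t _ => Matrix.pow_apply_nonneg hWnn t i i)
  have hα₃₁ : α₃ ≤ α₁ := by
    have : α₁ - α₃ = 1 / n * -T := by
      rw [hα₁, hα₃]; ring
    have h2 : 0 ≤ 1 / n * -T := mul_nonneg (by positivity) (by linarith)
    linarith
  have hβ0 : 0 < β := by rw [hβ]; positivity
  have hA : ((m : ℝ) - 1) / m * α₁ + 1 / m * α₃ = (w + L) / n ^ 2 := by
    rw [hα₁, hα₃]; field_simp; ring
  have hα₂' : α₂ = (w - L) / n ^ 2 := by rw [hα₂]; field_simp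
  have hsq : α₂ * (((m : ℝ) - 1) / m * α₁ + 1 / m * α₃) ≤ β ^ 2 := by
    rw [hA, hα₂', hβ, div_mul_div_comm, div_pow, ← sq]
    gcongr
    have : (w : ℝ) ^ 2 ≤ (k * w) ^ 2 := by
      gcongr
      nlinarith
    nlinarith
  have hν : 0 < nuOne m α₁ α₂ α₃ β := by
    refine Real.log_pos ?_
    rw [hA, one_lt_div (by linarith), hα₂']
    gcongr
    linarith
  have herg : IsErgodicLimit P X Z Np (Matrix.of fun _ _ => β) := by
    rw [hβ]
    exact isErgodicLimit_sbm hm1 hn hy ha0 hb0 hD hD0 hW hWnn hrow hr hw hk hXZ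
  have hmin := fun {Y : Matrix (Fin n) (Fin n) ℝ} (hY : Y.PosSemidef)
      (hne : Y ≠ communityGram y (nuOne m α₁ α₂ α₃ β)) =>
    gramObjective_communityGram_lt (Nminus := Matrix.of fun _ _ => β) hm1 hn hy hα₁0 hα₂0 hα₃0 hβ0
      hα₃₁ hsq hblock (fun _ _ => rfl) hY hne
  have hpsd := communityGram_posSemidef y hν.le
  have hrank := communityGram_rank y hν.ne'
  refine ⟨Np, Matrix.of fun _ _ => β, α₁, α₂, α₃, β, herg, hblock, fun _ _ => rfl, hβ,
    argminSet_eq_singleton hpsd fun Y hY => hmin hY, hrank,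
    fun d hd => argminSet_eq_singleton ⟨hpsd, hrank.trans_le hd⟩ fun Y hY => hmin hY.1,
    fun ν hνn => argminSet_eq_singleton
      ⟨hpsd, (nuclearNorm_communityGram_le y hν.le).trans hνn⟩ fun Y hY => hmin hY.1⟩
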